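/- Consider a Markov decision process with a measurable state space $S$, $C\ge 1$ actions $\{1,\dots,C\}$, initial state distribution $\mathcal P_0$, transition kernel $\mathcal P(s_{t+1}\mid s_t,a_t)$, measurable reward $r(s,a)\in\mathbb R$ and discount parameter $\gamma\in(0,1]$. For $\theta\in\mathbb R^d$ let $\mathcal T_\theta:S\to\mathbb R^C$ be measurable, and let $\pi_\theta$ be the softmax policy $\pi_\theta(a\mid s)=e^{\mathcal T_\theta(s)_a}/\sum_{i=1}^C e^{\mathcal T_\theta(s)_i}$. Write $J(\theta)=\mathbb E_{\pi_\theta}\big[\sum_{t\ge0}\gamma^t r(s_t,a_t)\big]$; let $Q(s,a)$ be the expectation of $\sum_{k\ge0}\gamma^{k}r(s_k,a_k)$ when the process starts at $(s_0,a_0)=(s,a)$ and follows $\pi_\theta$ afterwards; and let $\rho_\pi=\sum_{t\ge0}\gamma^t\,\mathbb P_{\pi_\theta}(s_t\in\cdot)$ be the unnormalized discounted state visitation measure. Fix $\theta$. Assume that $\theta'\mapsto\mathcal T_{\theta'}(s)$ is differentiable at $\theta$ for $\rho_\pi$-almost every $s$, and that there are $\varepsilon>0$ and a measurable $L:S\to[0,\infty)$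 such that for every $s$ the map $\theta'\mapsto\mathcal T_{\theta'}(s)$ is $L(s)$-Lipschitz on the ball $B(\theta,\varepsilon)$ (for the maximum norm on $\mathbb R^C$), and $$\sum_{t\ge0}\ \sup_{\theta'\in B(\theta,\varepsilon)}\mathbb E_{\pi_{\theta'}}\Big[\gamma^t|r(s_t,a_t)|\Big(1+\sum_{i=0}^{t}L(s_i)\Big)\Big]<\infty .$$ (This holds, for instance, when $r$ and $L$ are bounded and $\gamma<1$, or when $r$ and $L$ are bounded and the rewards vanish after a fixed time.) For a state $s$ put $\phi=\mathcal T_\theta(s)$. For $\varpi\in\mathbb R^C$ let $\varpi^{c\leftrightharpoons j}$ be $\varpi$ with its $c$th and $j$th entries swapped, and put $$a^{c\leftrightharpoons j}=\operatorname*{argmin}_{i\in\{1,\dots,C\}}\varpi_i^{c\leftrightharpoons j}e^{-\phi_i},\qquad f_\Delta^{c\leftrightharpoons j}(\varpi)=Q(s,a^{c\leftrightharpoons j})-\frac1C\sum_{m=1}^C Q(s,a^{m\leftrightharpoons j})$$ (ties in the argmin are broken by the least index). Then $J$ is differentiable at $\theta$, and $$\nabla_\theta J(\theta)=\mathbb E_{\varpi\sim\mathrm{Dir}(\mathbf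 1_C),\ s\sim\rho_\pi}\Big[\nabla_{\theta}\sum_{c=1}^C g_c\,\mathcal T_{\theta}(s)_c\Big],$$ where the gradient inside the expectation is taken with the weights $g_c$ held constant, where $\mathbb E_{s\sim\rho_\pi}$ denotes integration against $\rho_\pi$, and where the integrand is integrable, for each of the following two choices of $g_c$: (ARS) $g_c=f_\Delta^{c\leftrightharpoons j}(\varpi)\,(1-C\varpi_j)$, where the reference category $j$ is drawn at random from any probability distribution on $\{1,\dots,C\}$, independently of $(s,\varpi)$, and the expectation is taken over $j$ as well; (ARSM) $g_c=\sum_{j=1}^C f_\Delta^{c\leftrightharpoons j}(\varpi)\,\big(\tfrac1C-\varpi_j\big)$. -/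

import Mathlib

open MeasureTheory ProbabilityTheory
open scoped ENNReal NNReal

noncomputable section

/-- The softmax function `σ(φ)_c = exp φ_c / ∑ i, exp φ_i`. -/
def softmax {C : ℕ} (φ : Fin C → ℝ) (c : Fin C) : ℝ :=
  Real.exp (φ c) / ∑ i, Real.exp (φ i)

/-- The categorical distribution `Cat(σ(φ))` on `{1, …, C}`. -/
def catSoftmax {C : ℕ} (φ : Fin C → ℝ) : Measure (Fin C) :=
  ∑ c, ENNReal.ofReal (softmax φ c) • Measure.dirac c

lemma measurable_softmax {C : ℕ} (c : Fin C) :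
    Measurable (fun φ : Fin C → ℝ => softmax φ c) := by
  unfold softmax
  fun_prop

lemma softmax_nonneg {C : ℕ} (φ : Fin C → ℝ) (c : Fin C) : 0 ≤ softmax φ c := by
  unfold softmax
  positivity

lemma sum_softmax {C : ℕ} [NeZero C] (φ : Fin C → ℝ) : ∑ c, softmax φ c = 1 := by
  unfold softmax
  rw [← Finset.sum_div]
  exact div_self (Finset.sum_pos (fun i _ => Real.exp_pos _) Finset.univ_nonempty).ne'

/-- The policy `π(a | s) = Cat(a; σ(φ(s)))` with logits `φ : S → ℝ^C`. -/
def softmaxPolicy {S : Type*} [MeasurableSpace S] {C : ℕ}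
    (φ : S → Fin C → ℝ) (hφ : Measurable φ) : Kernel S (Fin C) where
  toFun s := catSoftmax (φ s)
  measurable' := by
    refine Measure.measurable_of_measurable_coe _ (fun B _ => ?_)
    simp only [catSoftmax, Measure.coe_finsetSum, Measure.coe_smul, Finset.sum_apply,
      Pi.smul_apply, smul_eq_mul]
    refine Finset.measurable_sum _ (fun c _ => ?_)
    exact (((measurable_softmax c).comp hφ).ennreal_ofReal).mul_const _

instance {S : Type*} [MeasurableSpace S] {C : ℕ} [NeZero C]
    (φ : S → Fin C → ℝ) (hφ : Measurable φ) : IsMarkovKernel (softmaxPolicy φ hφ) where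
  isProbabilityMeasure s := by
    constructor
    change catSoftmax (φ s) Set.univ = 1
    simp only [catSoftmax, Measure.coe_finsetSum, Measure.coe_smul, Finset.sum_apply,
      Pi.smul_apply, smul_eq_mul, measure_univ, mul_one]
    rw [← ENNReal.ofReal_sum_of_nonneg (fun c _ => softmax_nonneg _ _), sum_softmax,
      ENNReal.ofReal_one]

/-- A Markov decision process with state space `S`, the `C` actions `Fin C`, initial state
distribution `init`, transition kernel `trans` (the law of `s_{t+1}` given `(s_t, a_t)`), reward
function `reward` and discount parameter `γ ∈ (0, 1]`. -/
structure MDP (S : Type*) [MeasurableSpace S] (C : ℕ) where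
  init : Measure S
  isProb_init : IsProbabilityMeasure init
  trans : Kernel (S × Fin C) S
  isMarkov_trans : IsMarkovKernel trans
  reward : S × Fin C → ℝ
  measurable_reward : Measurable reward
  γ : ℝ
  γ_pos : 0 < γ
  γ_le_one : γ ≤ 1

attribute [instance] MDP.isProb_init MDP.isMarkov_trans

namespace MDP

variable {S : Type*} [MeasurableSpace S] {C : ℕ}

/-- One step of the state-action process under the policy `π`: from `(s, a)`, draw
`s' ∼ P(· | s, a)` and then `a' ∼ π(· | s')`. -/
def step (M : MDP S C) (π : Kernel S (Fin C)) [IsMarkovKernel π] :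
    Kernel (S × Fin C) (S × Fin C) :=
  M.trans ⊗ₖ (π.comap Prod.snd measurable_snd)

instance (M : MDP S C) (π : Kernel S (Fin C)) [IsMarkovKernel π] :
    IsMarkovKernel (M.step π) := by
  unfold step
  infer_instance

/-- The law of the trajectory `(s_t, a_t)_{t ≥ 0}` under the policy `π` when `(s_0, a_0)` has
law `μ`. -/
def trajFrom (M : MDP S C) (π : Kernel S (Fin C)) [IsMarkovKernel π] (μ : Measure (S × Fin C)) :
    Measure (ℕ → S × Fin C) :=
  Kernel.trajMeasure (X := fun _ => S × Fin C) μ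
    (fun n => (M.step π).comap (fun h => h ⟨n, Finset.mem_Iic.mpr le_rfl⟩)
      (measurable_pi_apply _))

/-- The law of the trajectory under `π`, with `s_0 ∼ init` and `a_0 ∼ π(· | s_0)`. -/
def traj (M : MDP S C) (π : Kernel S (Fin C)) [IsMarkovKernel π] : Measure (ℕ → S × Fin C) :=
  M.trajFrom π (M.init ⊗ₘ π)

/-- The discounted return `∑ t, γ ^ t * r(s_t, a_t)` of a trajectory. -/
def discountedReturn (M : MDP S C) (ω : ℕ → S × Fin C) : ℝ :=
  ∑' t, M.γ ^ t * M.reward (ω t)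

/-- The expected discounted return of the policy `π`. -/
def J (M : MDP S C) (π : Kernel S (Fin C)) [IsMarkovKernel π] : ℝ :=
  ∫ ω, M.discountedReturn ω ∂(M.traj π)

/-- The action-value function: the expected discounted return of the trajectory started from
the state-action pair `(s, a)` and following `π` afterwards. -/
def Q (M : MDP S C) (π : Kernel S (Fin C)) [IsMarkovKernel π] (s : S) (a : Fin C) : ℝ :=
  ∫ ω, M.discountedReturn ω ∂(M.trajFrom π (Measure.dirac (s, a)))

/-- The unnormalized discounted state visitation measure `∑ t, γ ^ t P(s_t ∈ ·)`. -/
def visitation (M : MDP S C) (π : Kernel S (Fin C)) [IsMarkovKernel π] : Measure S :=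
  Measure.sum fun t : ℕ => ENNReal.ofReal (M.γ ^ t) • (M.traj π).map (fun ω => (ω t).1)

end MDP

/-- The density of the Dirichlet distribution with parameters `α`, at a point `x` of the simplex. -/
def dirichletDensity {C : ℕ} (α x : Fin C → ℝ) : ℝ :=
  Real.Gamma (∑ i, α i) / (∏ i, Real.Gamma (α i)) * ∏ i, x i ^ (α i - 1)

/-- The point of the hyperplane `∑ i, x i = 1` with given first `n` coordinates. -/
def simplexPoint {n : ℕ} (y : Fin n → ℝ) : Fin (n + 1) → ℝ :=
  Fin.snoc (α := fun _ => ℝ) y (1 - ∑ i, y i)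

/-- The Dirichlet distribution `Dir(α)` on the simplex in `ℝ^C`: it has density
`dirichletDensity α` with respect to Lebesgue measure in the first `C - 1` coordinates. -/
def dirichlet : (C : ℕ) → (Fin C → ℝ) → Measure (Fin C → ℝ)
  | 0, _ => 0
  | n + 1, α =>
    (((volume : Measure (Fin n → ℝ)).restrict {y | ∀ i, 0 < simplexPoint y i}).withDensity
      (fun y => ENNReal.ofReal (dirichletDensity α (simplexPoint y)))).map simplexPoint

/-- The index of the smallest entry of `x` (the first one in case of ties). -/
def argmin {C : ℕ} [NeZero C] (x : Fin C → ℝ) : Fin C :=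
  (Finset.univ.filter fun i => ∀ j, x i ≤ x j).min'
    (let ⟨i, hi⟩ := Finite.exists_min x; ⟨i, by simpa using hi⟩)

/-- The vector obtained from `w` by swapping its `m`th and `j`th entries. -/
def swapEntries {C : ℕ} (w : Fin C → ℝ) (m j : Fin C) : Fin C → ℝ :=
  fun i => w (Equiv.swap m j i)

/-- The pseudo action `argmin_i w_i^{c ⇌ j} exp(-φ_i)`. -/
def pseudoAction {C : ℕ} [NeZero C] (φ w : Fin C → ℝ) (c j : Fin C) : Fin C :=
  argmin fun i => swapEntries w c j i * Real.exp (-φ i)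

/-- `f_Δ^{c ⇌ j}(w)`: the action value `q` at the `c`th pseudo action with reference `j`, minus the
average of the action values over all pseudo actions with reference `j`. -/
def fDelta {C : ℕ} [NeZero C] (q φ w : Fin C → ℝ) (c j : Fin C) : ℝ :=
  q (pseudoAction φ w c j) - 1 / (C : ℝ) * ∑ m, q (pseudoAction φ w m j)

/-- The ARS weights `g_c` with reference category `j`. -/
def gARS {C : ℕ} [NeZero C] (q φ w : Fin C → ℝ) (j c : Fin C) : ℝ :=
  fDelta q φ w c j * (1 - C * w j)

/-- The ARSM weights `g_c`. -/
def gARSM {C : ℕ} [NeZero C] (q φ w : Fin C → ℝ) (c : Fin C) : ℝ :=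
  ∑ j, fDelta q φ w c j * (1 / (C : ℝ) - w j)

end

/-! Write `σ = softmax φ`. The theorem combines an identity on the simplex with the policy gradient
theorem.

Simplex. If `x` has independent standard exponential coordinates, then `x / ∑ x_i` has law `Dir(1)`
(`dirichlet_one_eq_map_simplexProj`), and this scaling does not move the argmin. The linear map
sending `e_a` to `σ` and fixing the other basis vectors has determinant `σ_a`, preserves the
coordinate sum, and carries the positive orthant bijectively onto the part of it where `x_i
exp(-φ_i)` is strictly smallest at `a`. Hence that cell has mass `σ_a`, and conditionally on it `w`
is distributed as `w + w_a (σ - e_a)` for a fresh `Dir(1)` vector. As each coordinate has mean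
`1/C`, the conditional mean of `1 - C w_c` is `1_{c=a} - σ_c`, so `E[q(argmin) (1 - C w_c)] = σ_c
(q_c - ∑ σ_a q_a)`, the derivative of `∑ σ_a q_a` in `φ_c` (`integral_dirichlet_tiltedArgmin_mul`).
Swapping entries `c` and `j` preserves the law and replaces `w_c` by `w_j`. The baseline in `f_Δ`
adds no bias because these derivatives sum to zero over `c` (`integral_gARS`). ARSM is the average
of ARS over a uniform `j`.

Policy gradient. The law of the first `t + 1` state-action pairs under another policy has as density
the product of the action probability ratios. So `J` becomes one integral of `f exp(l_y)` over a
fixed measure, counting measure in `t` times the trajectory law at `θ`, where `l_y` is a sum of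
log-ratios and is Lipschitz in `y`. The hypothesis bounds integrals, not integrands, uniformly near
`θ`; a truncation replaces plain domination (`hasGradientAt_integral_mul_exp`). The derivative pairs
each reward at time `t` with the scores at times `i ≤ t`. Regrouping by `i` and `k = t - i`, the
Markov property turns the sum over `k` into `γ^i Q(s_i, a_i)`, the sum over `i` into the visitation
measure, and the mean over `a_i` into the simplex expression above (`integral_reward_smul_score`).
Fubini then joins the two halves. -/

/-! ### Trajectory laws: Markov property and change of measure -/

/-- Every finite set of times lies in an initial segment, and a projective limit of finite measures
is unique. -/
lemma MeasureTheory.Measure.ext_of_map_frestrictLe {X : Type*} [MeasurableSpace X]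
    {P P' : Measure (ℕ → X)} [IsFiniteMeasure P]
    (h : ∀ n, P.map (Preorder.frestrictLe n) = P'.map (Preorder.frestrictLe n)) : P = P' := by
  have hI : ∀ I : Finset ℕ, P.map I.restrict = P'.map I.restrict := by
    intro I
    have hsub : I ⊆ Finset.Iic (I.sup id) := I.subset_Iic_sup_id
    have hm : Measurable (Finset.restrict₂ (π := fun _ : ℕ => X) hsub) :=
      Finset.measurable_restrict₂ hsub
    rw [← Finset.restrict₂_comp_restrict hsub, ← Measure.map_map hm (by fun_prop),
      ← Measure.map_map hm (by fun_prop)]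
    exact congrArg _ (h (I.sup id))
  have h1 : IsProjectiveLimit P (fun I : Finset ℕ => P.map I.restrict) := fun I => rfl
  have h2 : IsProjectiveLimit P' (fun I : Finset ℕ => P.map I.restrict) := fun I => (hI I).symm
  exact h1.unique h2

/-- The prefix of length `n + 2` made of a prefix of length `n + 1` and one more state. -/
def appendState {X : Type*} (n : ℕ) (p : ((i : Finset.Iic n) → X) × X) :
    (i : Finset.Iic (n + 1)) → X :=
  fun i => if h : (i : ℕ) ≤ n then p.1 ⟨i, Finset.mem_Iic.mpr h⟩ else p.2

lemma measurable_appendState {X : Type*} [MeasurableSpace X] (n : ℕ) :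
    Measurable (appendState (X := X) n) := by
  refine measurable_pi_lambda _ fun i => ?_
  by_cases h : (i : ℕ) ≤ n
  · simp only [appendState, h, dite_true]; fun_prop
  · simp only [appendState, h, dite_false]; fun_prop

lemma appendState_frestrictLe {X : Type*} (n : ℕ) (ω : ℕ → X) :
    appendState n (Preorder.frestrictLe (π := fun _ => X) n ω, ω (n + 1)) =
      Preorder.frestrictLe (π := fun _ => X) (n + 1) ω := by
  ext i
  by_cases h : (i : ℕ) ≤ n
  · simp [appendState, h]
  · have : (i : ℕ) = n + 1 := by
      have := Finset.mem_Iic.mp i.2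
      omega
    simp [appendState, h, ← this]

namespace MDP

variable {S : Type*} [MeasurableSpace S] {C : ℕ} (M : MDP S C) (π : Kernel S (Fin C))
  [IsMarkovKernel π]

instance (μ : Measure (S × Fin C)) [IsProbabilityMeasure μ] :
    IsProbabilityMeasure (M.trajFrom π μ) := by
  unfold trajFrom; infer_instance

instance : IsProbabilityMeasure (M.traj π) := by
  unfold traj; infer_instance

/-- The law of the trajectory, as a kernel from the initial state-action pair. -/
noncomputable def trajKernel : Kernel (S × Fin C) (ℕ → S × Fin C) :=
  (Kernel.traj (X := fun _ => S × Fin C)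
    (fun n => (M.step π).comap (fun h => h ⟨n, Finset.mem_Iic.mpr le_rfl⟩)
      (measurable_pi_apply _)) 0).comap (MeasurableEquiv.piUnique
        (fun _ : Finset.Iic 0 => S × Fin C)).symm (MeasurableEquiv.measurable _)

instance : IsMarkovKernel (M.trajKernel π) := by
  unfold trajKernel; infer_instance

/-- Disintegration over the initial pair; it makes `Q` an integral against a kernel, hence
measurable in `(s, a)`. -/
lemma trajFrom_eq_comp (μ : Measure (S × Fin C)) :
    M.trajFrom π μ = M.trajKernel π ∘ₘ μ := by
  unfold trajFrom trajKernel Kernel.trajMeasure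
  ext s hs
  rw [Measure.bind_apply hs (Kernel.aemeasurable _), Measure.bind_apply hs (Kernel.aemeasurable _),
    lintegral_map (Kernel.measurable_coe _ hs) (MeasurableEquiv.measurable _)]
  rfl

lemma trajFrom_dirac (z : S × Fin C) : M.trajFrom π (Measure.dirac z) = M.trajKernel π z := by
  rw [trajFrom_eq_comp, Measure.dirac_bind (Kernel.measurable _)]

lemma trajKernel_map_zero (z : S × Fin C) :
    (M.trajKernel π z).map (fun ω => ω 0) = Measure.dirac z := by
  have h1 : (fun ω : ℕ → S × Fin C => ω 0) =
      (fun h : (i : Finset.Iic 0) → S × Fin C => h ⟨0, by simp⟩) ∘ Preorder.frestrictLe 0 := rfl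
  rw [h1, ← Measure.map_map (by fun_prop) (by fun_prop)]
  unfold trajKernel
  rw [Kernel.comap_apply, Kernel.traj_map_frestrictLe_apply, Kernel.partialTraj_self,
    Kernel.id_apply]
  exact Measure.map_dirac' (by fun_prop) _

/-- Coordinate `0` is almost surely the constant `z`, and a constant is independent of everything.
-/
lemma trajKernel_map_zero_prod (z : S × Fin C) :
    (M.trajKernel π z).map (fun ω => (ω 0, ω)) = (Measure.dirac z).prod (M.trajKernel π z) := by
  refine (Measure.prod_eq fun A B hA hB => ?_).symm
  rw [Measure.map_apply (by fun_prop) (hA.prod hB)]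
  have h0 : M.trajKernel π z ((fun ω => ω 0) ⁻¹' A) = Measure.dirac z A := by
    rw [← Measure.map_apply (by fun_prop) hA, trajKernel_map_zero]
  have hset : (fun ω : ℕ → S × Fin C => (ω 0, ω)) ⁻¹' A ×ˢ B = (fun ω => ω 0) ⁻¹' A ∩ B := rfl
  have hmA : MeasurableSet ((fun ω : ℕ → S × Fin C => ω 0) ⁻¹' A) :=
    (measurable_pi_apply 0) hA
  rw [hset]
  by_cases hz : z ∈ A
  · rw [Measure.dirac_apply' _ hA, Set.indicator_of_mem hz, Pi.one_apply] at *
    rw [one_mul]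
    refine measure_congr ?_
    filter_upwards [(mem_ae_iff_prob_eq_one hmA).mpr h0] with ω hω
    exact propext (and_iff_right hω)
  · rw [Measure.dirac_apply' _ hA, Set.indicator_of_notMem hz] at *
    rw [zero_mul]
    exact measure_mono_null Set.inter_subset_left h0

lemma trajFrom_map_zero (μ : Measure (S × Fin C)) :
    (M.trajFrom π μ).map (fun ω => ω 0) = μ := by
  rw [trajFrom_eq_comp, Measure.map_comp _ _ (by fun_prop)]
  have : (M.trajKernel π).map (fun ω => ω 0) = Kernel.id := by
    ext z : 1
    rw [Kernel.map_apply _ (by fun_prop), trajKernel_map_zero, Kernel.id_apply]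
  rw [this, Measure.id_comp]

lemma lintegral_trajFrom_succ (μ : Measure (S × Fin C)) [IsProbabilityMeasure μ] (n : ℕ)
    {f : ((i : Finset.Iic n) → S × Fin C) × (S × Fin C) → ℝ≥0∞} (hf : Measurable f) :
    ∫⁻ ω, f (Preorder.frestrictLe n ω, ω (n + 1)) ∂(M.trajFrom π μ) =
      ∫⁻ ω, ∫⁻ z, f (Preorder.frestrictLe n ω, z) ∂(M.step π (ω n)) ∂(M.trajFrom π μ) := by
  have h := Kernel.map_frestrictLe_trajMeasure_compProd_eq_map_trajMeasure
    (X := fun _ => S × Fin C) (μ₀ := μ)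
    (κ := fun n => (M.step π).comap (fun h => h ⟨n, Finset.mem_Iic.mpr le_rfl⟩)
      (measurable_pi_apply _)) (a := n)
  have h2 := congrArg (fun m => ∫⁻ x, f x ∂m) h
  rw [lintegral_map hf (by fun_prop), Measure.lintegral_compProd hf,
    lintegral_map (Measurable.lintegral_kernel_prod_right' hf) (by fun_prop)] at h2
  exact h2.symm

/-- The initial law and the one-step transitions determine all prefix laws by induction. Shifted
trajectories are identified by checking these two properties. -/
lemma eq_trajFrom (μ : Measure (S × Fin C)) [IsProbabilityMeasure μ]
    (P : Measure (ℕ → S × Fin C)) [IsFiniteMeasure P] (h0 : P.map (fun ω => ω 0) = μ)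
    (hstep : ∀ n, ∀ f : ((i : Finset.Iic n) → S × Fin C) × (S × Fin C) → ℝ≥0∞, Measurable f →
      ∫⁻ ω, f (Preorder.frestrictLe n ω, ω (n + 1)) ∂P =
        ∫⁻ ω, ∫⁻ z, f (Preorder.frestrictLe n ω, z) ∂(M.step π (ω n)) ∂P) :
    P = M.trajFrom π μ := by
  refine Measure.ext_of_map_frestrictLe fun n => ?_
  induction n with
  | zero =>
    have h1 : Preorder.frestrictLe (π := fun _ => S × Fin C) 0 =
      (MeasurableEquiv.piUnique (fun _ : Finset.Iic 0 => S × Fin C)).symm ∘ (fun ω => ω 0) := by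
      ext ω i
      · have := Finset.mem_Iic.mp i.2
        obtain ⟨i, hi⟩ := i
        obtain rfl : i = 0 := by simpa using hi
        rfl
      · have := Finset.mem_Iic.mp i.2
        obtain ⟨i, hi⟩ := i
        obtain rfl : i = 0 := by simpa using hi
        rfl
    rw [h1, ← Measure.map_map (MeasurableEquiv.measurable _) (by fun_prop), h0,
      ← Measure.map_map (MeasurableEquiv.measurable _) (by fun_prop), trajFrom_map_zero]
  | succ n ih =>
    refine Measure.ext_of_lintegral _ fun f hf => ?_
    rw [lintegral_map hf (by fun_prop), lintegral_map hf (by fun_prop)]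
    simp only [← appendState_frestrictLe n]
    have hm : Measurable (fun p => f (appendState n p)) := hf.comp (measurable_appendState n)
    rw [hstep n (fun p => f (appendState n p)) hm,
      M.lintegral_trajFrom_succ π μ n (f := fun p => f (appendState n p)) hm]
    have hg : Measurable (fun h : (i : Finset.Iic n) → S × Fin C =>
        ∫⁻ z, f (appendState n (h, z)) ∂(M.step π (h ⟨n, Finset.mem_Iic.mpr le_rfl⟩))) :=
      Measurable.lintegral_kernel_prod_right'
        (κ := (M.step π).comap (fun h : (i : Finset.Iic n) → S × Fin C =>
          h ⟨n, Finset.mem_Iic.mpr le_rfl⟩) (measurable_pi_apply _)) hm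
    have h2 := congrArg (fun m => ∫⁻ x, (∫⁻ z, f (appendState n (x, z)) ∂(M.step π (x ⟨n,
      Finset.mem_Iic.mpr le_rfl⟩))) ∂m) ih
    rwa [lintegral_map hg (by fun_prop), lintegral_map hg (by fun_prop)] at h2

/-- Since the step kernel does not depend on time, the shifted process satisfies the
characterisation `eq_trajFrom`; a prefix of the shift is a function of the prefix that is one step
longer. -/
lemma trajFrom_map_succ (μ : Measure (S × Fin C)) [IsProbabilityMeasure μ] :
    (M.trajFrom π μ).map (fun ω k => ω (k + 1)) =
      M.trajFrom π ((M.trajFrom π μ).map (fun ω => ω 1)) := by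
  have : IsProbabilityMeasure ((M.trajFrom π μ).map (fun ω => ω 1)) :=
    Measure.isProbabilityMeasure_map (measurable_pi_apply _).aemeasurable
  have hsh : Measurable (fun (ω : ℕ → S × Fin C) k => ω (k + 1)) := by fun_prop
  refine M.eq_trajFrom π _ _ ?_ fun n f hf => ?_
  · rw [Measure.map_map (by fun_prop) hsh]
    rfl
  · let sh : ((i : Finset.Iic (n + 1)) → S × Fin C) → ((i : Finset.Iic n) → S × Fin C) :=
      fun h i => h ⟨i + 1, by have := Finset.mem_Iic.mp i.2; simp; omega⟩
    have hsh' : Measurable sh := by fun_prop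
    have h1 : Measurable (fun p : ((i : Finset.Iic (n + 1)) → S × Fin C) × (S × Fin C) =>
      f (sh p.1, p.2)) := by fun_prop
    have h2 : Measurable fun ω : ℕ → S × Fin C =>
        ∫⁻ z, f (Preorder.frestrictLe n ω, z) ∂(M.step π (ω n)) :=
      Measurable.lintegral_kernel_prod_right' (f := fun p : (ℕ → S × Fin C) × (S × Fin C) =>
          f (Preorder.frestrictLe n p.1, p.2))
        (κ := (M.step π).comap (fun ω : ℕ → S × Fin C => ω n) (measurable_pi_apply _))
        (by fun_prop)
    rw [lintegral_map (by fun_prop) hsh, lintegral_map h2 hsh]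
    exact M.lintegral_trajFrom_succ π μ (n + 1) h1

lemma trajFrom_map_add (μ : Measure (S × Fin C)) [IsProbabilityMeasure μ] (i : ℕ) :
    (M.trajFrom π μ).map (fun ω k => ω (i + k)) =
      M.trajFrom π ((M.trajFrom π μ).map (fun ω => ω i)) := by
  induction i with
  | zero => simp [trajFrom_map_zero]
  | succ i ih =>
    have : IsProbabilityMeasure ((M.trajFrom π μ).map (fun ω => ω i)) :=
      Measure.isProbabilityMeasure_map (measurable_pi_apply _).aemeasurable
    have h1 : (fun (ω : ℕ → S × Fin C) k => ω (i + 1 + k)) =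
      (fun (ω : ℕ → S × Fin C) k => ω (k + 1)) ∘ (fun ω k => ω (i + k)) := by
      ext ω k <;> simp [add_assoc, add_comm 1 k]
    rw [h1, ← Measure.map_map (by fun_prop) (by fun_prop), ih, trajFrom_map_succ, ← ih,
      Measure.map_map (by fun_prop) (by fun_prop)]
    rfl

lemma trajFrom_map_zero_prod (μ : Measure (S × Fin C)) [IsProbabilityMeasure μ] :
    (M.trajFrom π μ).map (fun ω => (ω 0, ω)) = μ ⊗ₘ M.trajKernel π := by
  refine Measure.ext_of_lintegral _ fun f hf => ?_
  rw [lintegral_map hf (by fun_prop), Measure.lintegral_compProd hf, trajFrom_eq_comp,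
    Measure.lintegral_bind (Kernel.aemeasurable _) (by fun_prop)]
  refine lintegral_congr fun z => ?_
  rw [← lintegral_map (g := fun ω : ℕ → S × Fin C => (ω 0, ω)) hf (by fun_prop),
    trajKernel_map_zero_prod, lintegral_prod _ hf.aemeasurable,
    lintegral_dirac' _ hf.lintegral_prod_right']

/-- The Markov property at time `i`. -/
lemma trajFrom_map_prod_add (μ : Measure (S × Fin C)) [IsProbabilityMeasure μ] (i : ℕ) :
    (M.trajFrom π μ).map (fun ω => (ω i, fun k => ω (i + k))) =
      (M.trajFrom π μ).map (fun ω => ω i) ⊗ₘ M.trajKernel π := by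
  have : IsProbabilityMeasure ((M.trajFrom π μ).map (fun ω => ω i)) :=
    Measure.isProbabilityMeasure_map (measurable_pi_apply _).aemeasurable
  rw [← trajFrom_map_zero_prod, ← trajFrom_map_add, Measure.map_map (by fun_prop) (by fun_prop)]
  rfl

/-- Change of measure for the first steps of two trajectories. -/
lemma lintegral_trajFrom_changeOfMeasure (π' : Kernel S (Fin C)) [IsMarkovKernel π']
    (μ μ' : Measure (S × Fin C)) [IsProbabilityMeasure μ] [IsProbabilityMeasure μ']
    {w : S × Fin C → ℝ≥0∞} (hw : Measurable w)
    (h0 : ∀ f : S × Fin C → ℝ≥0∞, Measurable f → ∫⁻ z, f z ∂μ' = ∫⁻ z, f z * w z ∂μ)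
    (hstep : ∀ f : S × Fin C → ℝ≥0∞, Measurable f → ∀ y,
      ∫⁻ z, f z ∂(M.step π' y) = ∫⁻ z, f z * w z ∂(M.step π y))
    (n : ℕ) {f : ((i : Finset.Iic n) → S × Fin C) → ℝ≥0∞} (hf : Measurable f) :
    ∫⁻ ω, f (Preorder.frestrictLe n ω) ∂(M.trajFrom π' μ') =
      ∫⁻ ω, f (Preorder.frestrictLe n ω) * ∏ i ∈ Finset.range (n + 1), w (ω i)
        ∂(M.trajFrom π μ) := by
  induction n with
  | zero =>
    let e := fun z (_ : Finset.Iic 0) => (z : S × Fin C)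
    have he : ∀ ω : ℕ → S × Fin C, Preorder.frestrictLe (π := fun _ => S × Fin C) 0 ω =
        e (ω 0) := by
      intro ω
      funext ⟨i, hi⟩
      obtain rfl : i = 0 := by simpa using hi
      rfl
    have he' : Measurable e := by fun_prop
    simp only [he, zero_add, Finset.range_one, Finset.prod_singleton]
    rw [← lintegral_map (f := fun z => f (e z)) (g := fun ω : ℕ → S × Fin C => ω 0)
      (by fun_prop) (by fun_prop),
      ← lintegral_map (f := fun z => f (e z) * w z) (g := fun ω : ℕ → S × Fin C => ω 0)
      (by fun_prop) (by fun_prop), trajFrom_map_zero, trajFrom_map_zero]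
    exact h0 _ (by fun_prop)
  | succ n ih =>
    have hm : Measurable (fun p => f (appendState n p)) := hf.comp (measurable_appendState n)
    have hg : Measurable (fun h : (i : Finset.Iic n) → S × Fin C =>
        ∫⁻ z, f (appendState n (h, z)) ∂(M.step π' (h ⟨n, Finset.mem_Iic.mpr le_rfl⟩))) :=
      Measurable.lintegral_kernel_prod_right'
        (κ := (M.step π').comap (fun h : (i : Finset.Iic n) → S × Fin C =>
          h ⟨n, Finset.mem_Iic.mpr le_rfl⟩) (measurable_pi_apply _)) hm
    simp only [← appendState_frestrictLe n]
    rw [M.lintegral_trajFrom_succ π' μ' n (f := fun p => f (appendState n p)) hm]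
    refine (ih hg).trans ?_
    -- The product of weights is written as a function of the prefix alone, so that the one-step
    -- formula applies to the weighted integrand.
    have hp : ∀ (ω : ℕ → S × Fin C) (m : ℕ), ∏ i ∈ Finset.range (m + 1), w (ω i) =
        ∏ i : Finset.Iic m, w (Preorder.frestrictLe (π := fun _ => S × Fin C) m ω i) := by
      intro ω m
      rw [Finset.univ_eq_attach]
      simp only [Preorder.frestrictLe_apply]
      rw [Finset.prod_attach (Finset.Iic m) (fun i => w (ω i)), Nat.range_succ_eq_Iic]
    simp only [Finset.prod_range_succ _ (n + 1), hp]
    have hm2 : Measurable (fun p : ((i : Finset.Iic n) → S × Fin C) × (S × Fin C) =>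
        f (appendState n p) * ((∏ i, w (p.1 i)) * w p.2)) :=
      hm.mul ((Finset.measurable_prod _ fun i _ => by fun_prop).mul (by fun_prop))
    refine Eq.trans ?_ (M.lintegral_trajFrom_succ π μ n hm2).symm
    refine lintegral_congr fun ω => ?_
    simp only
    have hz : Measurable fun z => f (appendState n (Preorder.frestrictLe n ω, z)) :=
      hm.comp (by fun_prop)
    rw [hstep _ hz]
    refine (lintegral_mul_const _ (hz.mul hw)).symm.trans ?_
    refine lintegral_congr fun z => ?_
    rw [← mul_assoc, mul_right_comm]
    rfl

end MDP

/-! ### Softmax policies and likelihood ratios -/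

lemma softmax_pos {C : ℕ} (φ : Fin C → ℝ) (c : Fin C) : 0 < softmax φ c :=
  div_pos (Real.exp_pos _) (Finset.sum_pos (fun _ _ => Real.exp_pos _) ⟨c, Finset.mem_univ _⟩)

lemma lintegral_catSoftmax {C : ℕ} (φ : Fin C → ℝ) (f : Fin C → ℝ≥0∞) :
    ∫⁻ a, f a ∂(catSoftmax φ) = ∑ a, ENNReal.ofReal (softmax φ a) * f a := by
  simp [catSoftmax, lintegral_finsetSum_measure, lintegral_smul_measure]

lemma integral_catSoftmax {C : ℕ} {E : Type*} [NormedAddCommGroup E] [NormedSpace ℝ E]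
    [CompleteSpace E] (φ : Fin C → ℝ) (f : Fin C → E) :
    ∫ a, f a ∂(catSoftmax φ) = ∑ a, softmax φ a • f a := by
  have hi : ∀ c ∈ Finset.univ,
      Integrable f (ENNReal.ofReal (softmax φ c) • Measure.dirac c) := fun c _ =>
    (Integrable.of_finite (μ := Measure.dirac c)).smul_measure ENNReal.ofReal_ne_top
  rw [catSoftmax, integral_finsetSum_measure hi]
  refine Finset.sum_congr rfl fun c _ => ?_
  rw [integral_smul_measure, integral_dirac, ENNReal.toReal_ofReal (softmax_nonneg _ _)]

section Policy

variable {S : Type*} [MeasurableSpace S] {C : ℕ}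

lemma softmaxPolicy_apply (φ : S → Fin C → ℝ) (hφ : Measurable φ) (s : S) :
    softmaxPolicy φ hφ s = catSoftmax (φ s) := rfl

/-- The likelihood ratio of an action under the policies with logits `φ'` and `φ`. -/
noncomputable def policyRatio {S : Type*} {C : ℕ} (φ' φ : S → Fin C → ℝ) (z : S × Fin C) : ℝ :=
  softmax (φ' z.1) z.2 / softmax (φ z.1) z.2

lemma policyRatio_pos {S : Type*} {C : ℕ} (φ' φ : S → Fin C → ℝ) (z : S × Fin C) :
    0 < policyRatio φ' φ z :=
  div_pos (softmax_pos _ _) (softmax_pos _ _)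

lemma measurable_softmax_prod {φ : S → Fin C → ℝ} (hφ : Measurable φ) :
    Measurable (fun z : S × Fin C => softmax (φ z.1) z.2) :=
  measurable_from_prod_countable_left fun c => (measurable_softmax c).comp hφ

lemma measurable_policyRatio {φ' φ : S → Fin C → ℝ} (hφ' : Measurable φ') (hφ : Measurable φ) :
    Measurable (policyRatio φ' φ) :=
  (measurable_softmax_prod hφ').div (measurable_softmax_prod hφ)

/-- All softmax probabilities are positive, so any two softmax policies are mutually absolutely
continuous. -/
lemma lintegral_softmaxPolicy_eq_mul_policyRatio {φ' φ : S → Fin C → ℝ} (hφ' : Measurable φ')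
    (hφ : Measurable φ) (s : S) (f : S × Fin C → ℝ≥0∞) :
    ∫⁻ a, f (s, a) ∂(softmaxPolicy φ' hφ' s) =
      ∫⁻ a, f (s, a) * ENNReal.ofReal (policyRatio φ' φ (s, a)) ∂(softmaxPolicy φ hφ s) := by
  rw [softmaxPolicy_apply, softmaxPolicy_apply, lintegral_catSoftmax, lintegral_catSoftmax]
  refine Finset.sum_congr rfl fun a _ => ?_
  rw [mul_comm (f (s, a)), ← mul_assoc, ← ENNReal.ofReal_mul (softmax_nonneg _ _)]
  simp only [policyRatio]
  rw [mul_div_cancel₀ _ (softmax_pos (φ s) a).ne']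

namespace MDP

variable (M : MDP S C)

lemma lintegral_step (π : Kernel S (Fin C)) [IsMarkovKernel π] (y : S × Fin C)
    {f : S × Fin C → ℝ≥0∞} (hf : Measurable f) :
    ∫⁻ z, f z ∂(M.step π y) = ∫⁻ s, ∫⁻ a, f (s, a) ∂(π s) ∂(M.trans y) := by
  unfold step
  rw [Kernel.lintegral_compProd _ _ _ hf]
  rfl

/-- The likelihood ratio of the first `t + 1` actions under the policies with logits `φ'`
and `φ`. -/
noncomputable def trajRatio (φ' φ : S → Fin C → ℝ) (t : ℕ) (ω : ℕ → S × Fin C) : ℝ :=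
  ∏ i ∈ Finset.range (t + 1), policyRatio φ' φ (ω i)

lemma trajRatio_pos {S : Type*} {C : ℕ} (φ' φ : S → Fin C → ℝ) (t : ℕ) (ω : ℕ → S × Fin C) :
    0 < trajRatio φ' φ t ω :=
  Finset.prod_pos fun _ _ => policyRatio_pos _ _ _

lemma measurable_trajRatio {φ' φ : S → Fin C → ℝ} (hφ' : Measurable φ') (hφ : Measurable φ)
    (t : ℕ) : Measurable (trajRatio φ' φ t) := by
  have := measurable_policyRatio hφ' hφ
  unfold trajRatio
  exact Finset.measurable_prod _ fun i _ => by fun_prop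

lemma lintegral_traj_changeOfMeasure [NeZero C] {φ' φ : S → Fin C → ℝ} (hφ' : Measurable φ')
    (hφ : Measurable φ) (t : ℕ) {f : ((i : Finset.Iic t) → S × Fin C) → ℝ≥0∞}
    (hf : Measurable f) :
    ∫⁻ ω, f (Preorder.frestrictLe t ω) ∂(M.traj (softmaxPolicy φ' hφ')) =
      ∫⁻ ω, f (Preorder.frestrictLe t ω) * ENNReal.ofReal (trajRatio φ' φ t ω)
        ∂(M.traj (softmaxPolicy φ hφ)) := by
  have hw : Measurable fun z => ENNReal.ofReal (policyRatio φ' φ z) :=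
    (measurable_policyRatio hφ' hφ).ennreal_ofReal
  have h := M.lintegral_trajFrom_changeOfMeasure (softmaxPolicy φ hφ) (softmaxPolicy φ' hφ')
    (M.init ⊗ₘ softmaxPolicy φ hφ) (M.init ⊗ₘ softmaxPolicy φ' hφ') hw
    (fun g hg => by
      have hgw : Measurable fun z => g z * ENNReal.ofReal (policyRatio φ' φ z) := hg.mul hw
      rw [Measure.lintegral_compProd hg, Measure.lintegral_compProd hgw]
      exact lintegral_congr fun s => lintegral_softmaxPolicy_eq_mul_policyRatio hφ' hφ s g)
    (fun g hg y => by
      have hgw : Measurable fun z => g z * ENNReal.ofReal (policyRatio φ' φ z) := hg.mul hw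
      rw [lintegral_step _ _ _ hg, lintegral_step _ _ _ hgw]
      exact lintegral_congr fun s => lintegral_softmaxPolicy_eq_mul_policyRatio hφ' hφ s g)
    t hf
  unfold traj
  rw [h]
  refine lintegral_congr fun ω => ?_
  rw [trajRatio, ENNReal.ofReal_prod_of_nonneg fun i _ => (policyRatio_pos _ _ _).le]

/-- Obtained from an equality between laws of `ω t`, so that `f` need not be integrable. -/
lemma integral_traj_changeOfMeasure [NeZero C] {φ' φ : S → Fin C → ℝ} (hφ' : Measurable φ')
    (hφ : Measurable φ) (t : ℕ) {f : S × Fin C → ℝ} (hf : Measurable f) :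
    ∫ ω, f (ω t) ∂(M.traj (softmaxPolicy φ' hφ')) =
      ∫ ω, f (ω t) * trajRatio φ' φ t ω ∂(M.traj (softmaxPolicy φ hφ)) := by
  have hR := (measurable_trajRatio hφ' hφ t).ennreal_ofReal
  have hmap : (M.traj (softmaxPolicy φ' hφ')).map (fun ω => ω t) =
      ((M.traj (softmaxPolicy φ hφ)).withDensity
        fun ω => ENNReal.ofReal (trajRatio φ' φ t ω)).map (fun ω => ω t) := by
    refine Measure.ext_of_lintegral _ fun g hg => ?_
    rw [lintegral_map hg (by fun_prop), lintegral_map hg (by fun_prop),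
      lintegral_withDensity_eq_lintegral_mul _ hR (by fun_prop)]
    have h := M.lintegral_traj_changeOfMeasure hφ' hφ t
      (f := fun h => g (h ⟨t, Finset.mem_Iic.mpr le_rfl⟩)) (by fun_prop)
    refine h.trans (lintegral_congr fun ω => mul_comm _ _)
  rw [← integral_map (φ := fun ω : ℕ → S × Fin C => ω t) (measurable_pi_apply t).aemeasurable
      hf.aestronglyMeasurable, hmap,
    integral_map (measurable_pi_apply t).aemeasurable hf.aestronglyMeasurable,
    integral_withDensity_eq_integral_toReal_smul hR (by simp)]
  refine integral_congr_ae (Filter.Eventually.of_forall fun ω => ?_)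
  simp only [smul_eq_mul]
  rw [ENNReal.toReal_ofReal (trajRatio_pos _ _ _ _).le, mul_comm]

/-- At time `0` this is the choice of initial law; later it holds because `step` draws the action
from `π` at the new state. -/
lemma traj_map_eval (π : Kernel S (Fin C)) [IsMarkovKernel π] (i : ℕ) :
    (M.traj π).map (fun ω => ω i) = (M.traj π).map (fun ω => (ω i).1) ⊗ₘ π := by
  have : IsProbabilityMeasure ((M.traj π).map (fun ω => (ω i).1)) :=
    Measure.isProbabilityMeasure_map (measurable_pi_apply i).fst.aemeasurable
  refine Measure.ext_of_lintegral _ fun f hf => ?_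
  rw [Measure.lintegral_compProd hf, lintegral_map hf (by fun_prop),
    lintegral_map hf.lintegral_kernel_prod_right' (by fun_prop)]
  have hf' : Measurable fun s => ∫⁻ a, f (s, a) ∂(π s) := hf.lintegral_kernel_prod_right'
  have hf'' : Measurable fun z : S × Fin C => ∫⁻ a, f (z.1, a) ∂(π z.1) :=
    hf'.comp measurable_fst
  unfold traj
  cases i with
  | zero =>
    rw [← lintegral_map (g := fun ω : ℕ → S × Fin C => ω 0) hf (by fun_prop),
      ← lintegral_map (f := fun z => ∫⁻ a, f (z.1, a) ∂(π z.1))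
        (g := fun ω : ℕ → S × Fin C => ω 0) hf'' (by fun_prop),
      trajFrom_map_zero, Measure.lintegral_compProd hf,
      Measure.lintegral_compProd hf'']
    simp
  | succ i =>
    rw [M.lintegral_trajFrom_succ π _ i (f := fun p => f p.2) (by fun_prop),
      M.lintegral_trajFrom_succ π _ i (f := fun p => ∫⁻ a, f (p.2.1, a) ∂(π p.2.1))
        (hf'.comp (by fun_prop))]
    refine lintegral_congr fun ω => ?_
    simp only
    rw [lintegral_step _ _ _ hf, lintegral_step _ _ _ hf'']
    simp

end MDP

end Policy

/-! ### The flat Dirichlet law as normalised exponentials -/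

/-- The law of `C` independent standard exponential variables. -/
noncomputable def expOrthant (C : ℕ) : Measure (Fin C → ℝ) :=
  ((volume : Measure (Fin C → ℝ)).restrict {x | ∀ i, 0 < x i}).withDensity
    fun x => ENNReal.ofReal (Real.exp (-∑ i, x i))

lemma measurableSet_pos_orthant (C : ℕ) : MeasurableSet {x : Fin C → ℝ | ∀ i, 0 < x i} := by
  simp only [Set.ofPred_forall]
  exact MeasurableSet.iInter fun i => measurableSet_lt measurable_const (measurable_pi_apply i)

/-- An indicator inside an integral over the whole space lets linear changes of variables act
without tracking image sets. -/
lemma lintegral_expOrthant {C : ℕ} {F : (Fin C → ℝ) → ℝ≥0∞} (hF : Measurable F) :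
    ∫⁻ x, F x ∂(expOrthant C) =
      ∫⁻ x, {x : Fin C → ℝ | ∀ i, 0 < x i}.indicator
        (fun x => ENNReal.ofReal (Real.exp (-∑ i, x i)) * F x) x := by
  rw [expOrthant, lintegral_withDensity_eq_lintegral_mul _ (by fun_prop) hF,
    lintegral_indicator (measurableSet_pos_orthant C)]
  rfl

lemma expOrthant_ae_pos (C : ℕ) : ∀ᵐ x ∂(expOrthant C), ∀ i, 0 < x i :=
  (withDensity_absolutelyContinuous _ _).ae_le (ae_restrict_mem (measurableSet_pos_orthant C))

instance (C : ℕ) : IsProbabilityMeasure (expOrthant C) := by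
  constructor
  have h := lintegral_expOrthant (C := C) (F := fun _ => 1) measurable_const
  rw [lintegral_one] at h
  rw [h]
  have h1 : ∀ x : Fin C → ℝ, {x : Fin C → ℝ | ∀ i, 0 < x i}.indicator
      (fun x => ENNReal.ofReal (Real.exp (-∑ i, x i)) * 1) x =
      ENNReal.ofReal (∏ i, (Set.Ioi (0 : ℝ)).indicator (fun t => Real.exp (-t)) (x i)) := by
    intro x
    by_cases hx : ∀ i, 0 < x i
    · rw [Set.indicator_of_mem (show x ∈ {x : Fin C → ℝ | ∀ i, 0 < x i} from hx), mul_one,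
        ← Finset.sum_neg_distrib, Real.exp_sum]
      congr 1
      exact Finset.prod_congr rfl fun i _ =>
        (Set.indicator_of_mem (show x i ∈ Set.Ioi (0 : ℝ) from hx i) (fun t => Real.exp (-t))).symm
    · rw [Set.indicator_of_notMem (show x ∉ {x : Fin C → ℝ | ∀ i, 0 < x i} from hx)]
      push Not at hx
      obtain ⟨i, hi⟩ := hx
      rw [Finset.prod_eq_zero (Finset.mem_univ i), ENNReal.ofReal_zero]
      exact Set.indicator_of_notMem (by simpa using hi) _
  have hint : Integrable ((Set.Ioi (0 : ℝ)).indicator fun t => Real.exp (-t)) :=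
    (integrable_indicator_iff measurableSet_Ioi).mpr (integrableOn_exp_neg_Ioi 0)
  simp only [h1]
  rw [← ofReal_integral_eq_lintegral_ofReal]
  · rw [integral_fintype_prod_volume_eq_prod, integral_indicator measurableSet_Ioi,
      integral_exp_neg_Ioi]
    simp
  · exact Integrable.fintype_prod (μ := fun _ => (volume : Measure ℝ)) fun _ => hint
  · refine Filter.Eventually.of_forall fun x => Finset.prod_nonneg fun i _ => ?_
    exact Set.indicator_nonneg (fun t _ => (Real.exp_pos _).le) _

/-- The point of the simplex proportional to `x`. -/
noncomputable def simplexProj {C : ℕ} (x : Fin C → ℝ) : Fin C → ℝ := (∑ i, x i)⁻¹ • x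

lemma measurable_simplexProj {C : ℕ} : Measurable (simplexProj (C := C)) := by
  unfold simplexProj
  fun_prop

lemma sum_simplexPoint {n : ℕ} (y : Fin n → ℝ) : ∑ i, simplexPoint y i = 1 := by
  rw [Fin.sum_univ_castSucc]
  simp [simplexPoint]

lemma measurable_simplexPoint {n : ℕ} : Measurable (simplexPoint (n := n)) := by
  refine measurable_pi_lambda _ fun i => ?_
  refine Fin.lastCases ?_ (fun i => ?_) i
  · simp only [simplexPoint, Fin.snoc_last]; fun_prop
  · simp only [simplexPoint, Fin.snoc_castSucc]; fun_prop

lemma lintegral_smul_comp {n : ℕ} {s : ℝ} (hs : 0 < s) {G : (Fin n → ℝ) → ℝ≥0∞}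
    (hG : Measurable G) :
    ∫⁻ y, G y = ENNReal.ofReal (s ^ n) * ∫⁻ y, G (s • y) := by
  rw [← lintegral_map (μ := volume) (g := fun y : Fin n → ℝ => s • y) hG (by fun_prop),
    Measure.map_addHaar_smul _ hs.ne', lintegral_smul_measure, smul_eq_mul, ← mul_assoc,
    ← ENNReal.ofReal_mul (by positivity), Module.finrank_fin_fun, abs_of_pos (by positivity),
    mul_inv_cancel₀ (by positivity), ENNReal.ofReal_one, one_mul]

/-- Polar coordinates with respect to the sum of the coordinates. -/
lemma lintegral_eq_lintegral_smul_simplexPoint {n : ℕ} {G : (Fin (n + 1) → ℝ) → ℝ≥0∞}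
    (hG : Measurable G) (hG0 : ∀ x, ∑ i, x i ≤ 0 → G x = 0) :
    ∫⁻ x, G x = ∫⁻ s in Set.Ioi (0 : ℝ), ENNReal.ofReal (s ^ n) *
      ∫⁻ y : Fin n → ℝ, G (s • simplexPoint y) := by
  have hsnoc : Measurable fun p : ℝ × (Fin n → ℝ) =>
      (Fin.snoc (α := fun _ => ℝ) p.2 p.1 : Fin (n + 1) → ℝ) := by
    refine measurable_pi_lambda _ fun i => ?_
    refine Fin.lastCases ?_ (fun i => ?_) i
    · simp only [Fin.snoc_last]; fun_prop
    · simp only [Fin.snoc_castSucc]; fun_prop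
  have hGs : Measurable fun p : ℝ × (Fin n → ℝ) =>
      G (Fin.snoc (α := fun _ => ℝ) p.2 p.1) := hG.comp hsnoc
  have e := (volume_preserving_piFinSuccAbove (fun _ : Fin (n + 1) => ℝ) (Fin.last n)).symm
  have h1 : ∫⁻ x, G x = ∫⁻ p : ℝ × (Fin n → ℝ),
      G (Fin.snoc (α := fun _ => ℝ) p.2 p.1) := by
    rw [← e.lintegral_comp hG]
    refine lintegral_congr fun p => ?_
    congr 1
    exact Fin.insertNth_last' _ _
  rw [h1, Measure.volume_eq_prod, lintegral_prod_symm' _ hGs]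
  -- The last coordinate is exchanged for the total sum `s` by a translation; scaling `y` by `s`
  -- below then produces the Jacobian `s ^ n`.
  have h2 : ∀ y : Fin n → ℝ, ∫⁻ z : ℝ, G (Fin.snoc (α := fun _ => ℝ) y z) =
      ∫⁻ s : ℝ, G (Fin.snoc (α := fun _ => ℝ) y (s - ∑ i, y i)) := fun y =>
    (lintegral_sub_right_eq_self (fun z => G (Fin.snoc (α := fun _ => ℝ) y z)) _).symm
  simp only [h2]
  have hm : Measurable fun p : (Fin n → ℝ) × ℝ =>
      G (Fin.snoc (α := fun _ => ℝ) p.1 (p.2 - ∑ i, p.1 i)) :=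
    hG.comp (hsnoc.comp (by fun_prop : Measurable fun p : (Fin n → ℝ) × ℝ =>
      (p.2 - ∑ i, p.1 i, p.1)))
  rw [lintegral_lintegral_swap hm.aemeasurable, ← lintegral_indicator measurableSet_Ioi]
  refine lintegral_congr fun s => ?_
  by_cases hs : 0 < s
  · rw [Set.indicator_of_mem (Set.mem_Ioi.mpr hs)]
    refine (lintegral_smul_comp hs (hm.comp (measurable_id.prodMk measurable_const))).trans ?_
    congr 1
    refine lintegral_congr fun y => ?_
    simp only [Function.comp, id]
    congr 1
    ext i
    refine Fin.lastCases ?_ (fun i => ?_) i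
    · simp [simplexPoint, mul_sub, Finset.mul_sum]
    · simp [simplexPoint]
  · rw [Set.indicator_of_notMem (by simpa using hs)]
    have h0 : ∀ y : Fin n → ℝ, G (Fin.snoc (α := fun _ => ℝ) y (s - ∑ i, y i)) = 0 := by
      intro y
      refine hG0 _ ?_
      rw [Fin.sum_univ_castSucc]
      simpa using hs
    simp only [h0, lintegral_zero]

/-- The radial integral, which supplies the normalising constant of `Dir(1)` in dimension `n + 1`.
-/
lemma lintegral_Ioi_pow_mul_exp_neg (n : ℕ) :
    ∫⁻ s in Set.Ioi (0 : ℝ), ENNReal.ofReal (s ^ n) * ENNReal.ofReal (Real.exp (-s)) =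
      ENNReal.ofReal (Real.Gamma (n + 1)) := by
  rw [Real.Gamma_eq_integral (by positivity), ofReal_integral_eq_lintegral_ofReal
    (Real.GammaIntegral_convergent (by positivity))]
  · refine setLIntegral_congr_fun measurableSet_Ioi fun s hs => ?_
    have hs : (0 : ℝ) < s := hs
    simp only [add_sub_cancel_right, Real.rpow_natCast]
    rw [← ENNReal.ofReal_mul (by positivity), mul_comm]
  · refine (ae_restrict_iff' measurableSet_Ioi).mpr (Filter.Eventually.of_forall fun s hs => ?_)
    have hs : (0 : ℝ) < s := hs
    simp only [Pi.zero_apply]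
    positivity

/-- In the coordinates `s • simplexPoint y` the exponential density is `exp (-s)`, with Jacobian `s
^ n`, while the normalised vector depends on `y` only. Integrating out `s` leaves the constant
density `Γ(n + 1)`. -/
lemma dirichlet_one_eq_map_simplexProj (C : ℕ) [NeZero C] :
    dirichlet C (fun _ => 1) = (expOrthant C).map simplexProj := by
  obtain ⟨n, rfl⟩ := Nat.exists_eq_succ_of_ne_zero (NeZero.ne C)
  refine Measure.ext_of_lintegral _ fun F hF => ?_
  have hset : MeasurableSet {y : Fin n → ℝ | ∀ i, 0 < simplexPoint y i} :=
    measurable_simplexPoint (measurableSet_pos_orthant (n + 1))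
  have hdens : ∀ y : Fin n → ℝ, dirichletDensity (fun _ : Fin (n + 1) => 1) (simplexPoint y) =
      Real.Gamma (n + 1) := by
    intro y
    simp [dirichletDensity]
  have hFp : Measurable fun x : Fin (n + 1) → ℝ => F (simplexProj x) :=
    hF.comp measurable_simplexProj
  rw [lintegral_map hF measurable_simplexProj, lintegral_expOrthant hFp,
    lintegral_eq_lintegral_smul_simplexPoint]
  · unfold dirichlet
    simp only [hdens]
    rw [lintegral_map hF measurable_simplexPoint, withDensity_const, lintegral_smul_measure,
      ← lintegral_indicator hset, smul_eq_mul, ← lintegral_Ioi_pow_mul_exp_neg,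
      ← lintegral_mul_const _ (by fun_prop)]
    refine setLIntegral_congr_fun measurableSet_Ioi fun s hs => ?_
    have hs : (0 : ℝ) < s := hs
    have hFs : Measurable fun y : Fin n → ℝ => F (simplexPoint y) :=
      hF.comp measurable_simplexPoint
    rw [mul_assoc, ← lintegral_const_mul _ (hFs.indicator hset)]
    congr 1
    refine lintegral_congr fun y => ?_
    have hsum : ∑ i, (s • simplexPoint y) i = s := by
      simp [← Finset.mul_sum, sum_simplexPoint]
    by_cases hy : ∀ i, 0 < simplexPoint y i
    · rw [Set.indicator_of_mem
        (show y ∈ {y : Fin n → ℝ | ∀ i, 0 < simplexPoint y i} from hy), Set.indicator_of_mem, hsum]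
      · simp only [simplexProj, hsum]
        rw [smul_smul, inv_mul_cancel₀ hs.ne', one_smul]
      · intro i
        exact mul_pos hs (hy i)
    · rw [Set.indicator_of_notMem
        (show y ∉ {y : Fin n → ℝ | ∀ i, 0 < simplexPoint y i} from hy), Set.indicator_of_notMem,
        mul_zero]
      intro h
      exact hy fun i => pos_of_mul_pos_right (h i) hs.le
  · exact Measurable.indicator (Measurable.mul (by fun_prop) hFp)
      (measurableSet_pos_orthant _)
  · intro x hx
    refine Set.indicator_of_notMem (fun h => hx.not_gt ?_) _
    exact Finset.sum_pos (fun i _ => h i) Finset.univ_nonempty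

/-! ### The argmin cells of the exponential law -/

/-- The linear map sending the vertex `a` of the simplex to `softmax φ`, and fixing the others. -/
noncomputable def shrinkMap {C : ℕ} (φ : Fin C → ℝ) (a : Fin C) :
    (Fin C → ℝ) →ₗ[ℝ] (Fin C → ℝ) :=
  LinearMap.transvection (LinearMap.proj a) (softmax φ - Pi.single a 1)

lemma shrinkMap_apply {C : ℕ} (φ : Fin C → ℝ) (a : Fin C) (x : Fin C → ℝ) (i : Fin C) :
    shrinkMap φ a x i = x i + x a * (softmax φ i - if i = a then 1 else 0) := by
  simp [shrinkMap, LinearMap.transvection.apply, Pi.single_apply]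

/-- A transvection `x ↦ x + f(x) v` has determinant `1 + f(v)`, here `1 + (softmax φ a - 1)`. -/
lemma det_shrinkMap {C : ℕ} (φ : Fin C → ℝ) (a : Fin C) :
    LinearMap.det (shrinkMap φ a) = softmax φ a := by
  simp [shrinkMap]

/-- The direction `softmax φ - e_a` has coordinate sum zero. Hence the density `exp (-∑ x_i)` is
unchanged along the map. -/
lemma sum_shrinkMap {C : ℕ} [NeZero C] (φ : Fin C → ℝ) (a : Fin C) (x : Fin C → ℝ) :
    ∑ i, shrinkMap φ a x i = ∑ i, x i := by
  simp only [shrinkMap_apply, Finset.sum_add_distrib, ← Finset.mul_sum, Finset.sum_sub_distrib,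
    sum_softmax]
  simp

/-- The vectors `x` for which `x i * exp (-φ i)` is smallest at `i = a` only. -/
def strictArgminSet {C : ℕ} (φ : Fin C → ℝ) (a : Fin C) : Set (Fin C → ℝ) :=
  {x | ∀ i, i ≠ a → x a * Real.exp (-φ a) < x i * Real.exp (-φ i)}

lemma measurableSet_strictArgminSet {C : ℕ} (φ : Fin C → ℝ) (a : Fin C) :
    MeasurableSet (strictArgminSet φ a) := by
  simp only [strictArgminSet, Set.ofPred_forall]
  exact MeasurableSet.iInter fun i => MeasurableSet.iInter fun _ =>
    measurableSet_lt (by fun_prop) (by fun_prop)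

/-- Independence of `i` is the point: the terms in `x a` cancel when the tilted coordinates of
`shrinkMap φ a x` are compared. -/
lemma softmax_mul_exp_neg {C : ℕ} (φ : Fin C → ℝ) (i : Fin C) :
    softmax φ i * Real.exp (-φ i) = (∑ j, Real.exp (φ j))⁻¹ := by
  rw [softmax, div_mul_eq_mul_div, ← Real.exp_add, add_neg_cancel, Real.exp_zero, one_div]

lemma shrinkMap_self {C : ℕ} (φ : Fin C → ℝ) (a : Fin C) (x : Fin C → ℝ) :
    shrinkMap φ a x a = x a * softmax φ a := by
  rw [shrinkMap_apply, if_pos rfl]; ring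

lemma shrinkMap_of_ne {C : ℕ} (φ : Fin C → ℝ) {a i : Fin C} (h : i ≠ a) (x : Fin C → ℝ) :
    shrinkMap φ a x i = x i + x a * softmax φ i := by
  rw [shrinkMap_apply, if_neg h]; ring

lemma shrinkMap_lt_iff {C : ℕ} (φ : Fin C → ℝ) {a i : Fin C} (h : i ≠ a) (x : Fin C → ℝ) :
    shrinkMap φ a x a * Real.exp (-φ a) < shrinkMap φ a x i * Real.exp (-φ i) ↔ 0 < x i := by
  rw [shrinkMap_self, shrinkMap_of_ne φ h, mul_assoc, softmax_mul_exp_neg, add_mul, mul_assoc,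
    softmax_mul_exp_neg, lt_add_iff_pos_left]
  exact mul_pos_iff_of_pos_right (Real.exp_pos _)

/-- For `i ≠ a`, positivity of `x i` is the strict inequality between tilted coordinates `a` and `i`
of the image; positivity of `x a` is that of the image's coordinate `a`. -/
lemma pos_iff_shrinkMap {C : ℕ} (φ : Fin C → ℝ) (a : Fin C) (x : Fin C → ℝ) :
    (∀ i, 0 < x i) ↔
      (∀ i, 0 < shrinkMap φ a x i) ∧ shrinkMap φ a x ∈ strictArgminSet φ a := by
  constructor
  · intro h
    refine ⟨fun i => ?_, fun i hi => (shrinkMap_lt_iff φ hi x).mpr (h i)⟩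
    by_cases hi : i = a
    · subst hi
      rw [shrinkMap_self]
      exact mul_pos (h i) (softmax_pos φ i)
    · rw [shrinkMap_of_ne φ hi]
      exact add_pos (h i) (mul_pos (h a) (softmax_pos φ i))
  · rintro ⟨h1, h2⟩ i
    by_cases hi : i = a
    · subst hi
      have := h1 i
      rw [shrinkMap_self] at this
      exact pos_of_mul_pos_left this (softmax_pos φ i).le
    · exact (shrinkMap_lt_iff φ hi x).mp (h2 i hi)

lemma measurable_shrinkMap {C : ℕ} (φ : Fin C → ℝ) (a : Fin C) :
    Measurable (shrinkMap φ a) :=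
  (LinearMap.continuous_of_finiteDimensional _).measurable

/-- Change of variables along `shrinkMap φ a`: the density is preserved, the orthant corresponds to
the cell, and the determinant becomes the mass of the cell. -/
lemma setLIntegral_strictArgminSet {C : ℕ} [NeZero C] (φ : Fin C → ℝ) (a : Fin C)
    {F : (Fin C → ℝ) → ℝ≥0∞} (hF : Measurable F) :
    ∫⁻ x in strictArgminSet φ a, F x ∂(expOrthant C) =
      ENNReal.ofReal (softmax φ a) * ∫⁻ x, F (shrinkMap φ a x) ∂(expOrthant C) := by
  have hD := measurableSet_strictArgminSet φ a
  have hFA : Measurable fun x => F (shrinkMap φ a x) := hF.comp (measurable_shrinkMap φ a)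
  rw [← lintegral_indicator hD, lintegral_expOrthant (hF.indicator hD), lintegral_expOrthant hFA]
  set G : (Fin C → ℝ) → ℝ≥0∞ := fun y => {x : Fin C → ℝ | ∀ i, 0 < x i}.indicator
    (fun x => ENNReal.ofReal (Real.exp (-∑ i, x i)) * (strictArgminSet φ a).indicator F x) y
    with hG
  have hGm : Measurable G :=
    Measurable.indicator (Measurable.mul (by fun_prop) (hF.indicator hD))
      (measurableSet_pos_orthant C)
  have h1 : ∀ x, {x : Fin C → ℝ | ∀ i, 0 < x i}.indicator
      (fun x => ENNReal.ofReal (Real.exp (-∑ i, x i)) * F (shrinkMap φ a x)) x =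
      G (shrinkMap φ a x) := by
    intro x
    by_cases hx : ∀ i, 0 < x i
    · have h2 := (pos_iff_shrinkMap φ a x).mp hx
      rw [Set.indicator_of_mem (show x ∈ {x : Fin C → ℝ | ∀ i, 0 < x i} from hx), hG]
      simp only
      rw [Set.indicator_of_mem (show shrinkMap φ a x ∈ {x : Fin C → ℝ | ∀ i, 0 < x i} from h2.1),
        Set.indicator_of_mem h2.2, sum_shrinkMap]
    · rw [Set.indicator_of_notMem (show x ∉ {x : Fin C → ℝ | ∀ i, 0 < x i} from hx), hG]
      simp only
      by_cases h2 : ∀ i, 0 < shrinkMap φ a x i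
      · rw [Set.indicator_of_mem (show shrinkMap φ a x ∈ {x : Fin C → ℝ | ∀ i, 0 < x i} from h2),
          Set.indicator_of_notMem (fun h3 => hx ((pos_iff_shrinkMap φ a x).mpr ⟨h2, h3⟩)),
          mul_zero]
      · rw [Set.indicator_of_notMem]
        exact h2
  change ∫⁻ x, G x = _ * ∫⁻ x, {x : Fin C → ℝ | ∀ i, 0 < x i}.indicator
      (fun x => ENNReal.ofReal (Real.exp (-∑ i, x i)) * F (shrinkMap φ a x)) x
  simp only [h1]
  have hdet : LinearMap.det (shrinkMap φ a) ≠ 0 := by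
    rw [det_shrinkMap]; exact (softmax_pos φ a).ne'
  rw [← lintegral_map hGm (measurable_shrinkMap φ a),
    Measure.map_linearMap_addHaar_eq_smul_addHaar _ hdet, lintegral_smul_measure, smul_eq_mul,
    ← mul_assoc, ← ENNReal.ofReal_mul (softmax_nonneg _ _), det_shrinkMap,
    abs_of_pos (inv_pos.mpr (softmax_pos φ a)), mul_inv_cancel₀ (softmax_pos φ a).ne',
    ENNReal.ofReal_one, one_mul]

lemma restrict_strictArgminSet {C : ℕ} [NeZero C] (φ : Fin C → ℝ) (a : Fin C) :
    (expOrthant C).restrict (strictArgminSet φ a) =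
      ENNReal.ofReal (softmax φ a) • (expOrthant C).map (shrinkMap φ a) := by
  refine Measure.ext_of_lintegral _ fun F hF => ?_
  rw [setLIntegral_strictArgminSet φ a hF, lintegral_smul_measure, smul_eq_mul,
    lintegral_map hF (measurable_shrinkMap φ a)]

lemma expOrthant_strictArgminSet {C : ℕ} [NeZero C] (φ : Fin C → ℝ) (a : Fin C) :
    expOrthant C (strictArgminSet φ a) = ENNReal.ofReal (softmax φ a) := by
  have h := setLIntegral_strictArgminSet φ a (F := fun _ => 1) measurable_const
  simpa using h

lemma pairwise_disjoint_strictArgminSet {C : ℕ} (φ : Fin C → ℝ) :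
    Pairwise (Function.onFun Disjoint (strictArgminSet φ)) := by
  intro a b hab
  refine Set.disjoint_left.mpr fun x hxa hxb => ?_
  exact lt_asymm (hxa b hab.symm) (hxb a hab)

/-- The disjoint cells have masses `softmax φ a`, which sum to one, so ties are negligible without a
separate argument. -/
lemma expOrthant_ae_mem_iUnion_strictArgminSet {C : ℕ} [NeZero C] (φ : Fin C → ℝ) :
    ∀ᵐ x ∂(expOrthant C), x ∈ ⋃ a, strictArgminSet φ a := by
  rw [← Set.ofPred_mem_eq (s := ⋃ a, strictArgminSet φ a)]
  refine (mem_ae_iff_prob_eq_one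
    (MeasurableSet.iUnion fun a => measurableSet_strictArgminSet φ a)).mpr ?_
  rw [measure_iUnion (pairwise_disjoint_strictArgminSet φ) (measurableSet_strictArgminSet φ),
    tsum_fintype]
  simp only [expOrthant_strictArgminSet]
  rw [← ENNReal.ofReal_sum_of_nonneg fun c _ => softmax_nonneg _ _, sum_softmax,
    ENNReal.ofReal_one]

lemma argmin_le {C : ℕ} [NeZero C] (x : Fin C → ℝ) (j : Fin C) : x (argmin x) ≤ x j := by
  have h : argmin x ∈ Finset.univ.filter fun i => ∀ j, x i ≤ x j := Finset.min'_mem _ _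
  exact (Finset.mem_filter.mp h).2 j

lemma argmin_eq_of_forall_lt {C : ℕ} [NeZero C] {x : Fin C → ℝ} {a : Fin C}
    (h : ∀ i, i ≠ a → x a < x i) : argmin x = a := by
  by_contra hne
  exact (h _ hne).not_ge (argmin_le x a)

lemma argmin_smul {C : ℕ} [NeZero C] (x : Fin C → ℝ) {s : ℝ} (hs : 0 < s) :
    argmin (fun i => s * x i) = argmin x := by
  simp only [argmin, mul_le_mul_iff_right₀ hs]

lemma measurable_argmin {C : ℕ} [NeZero C] : Measurable (argmin (C := C)) := by
  refine measurable_to_countable' fun a => ?_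
  have h : argmin (C := C) ⁻¹' {a} =
      {x | ∀ j, x a ≤ x j} ∩ {x | ∀ i, i < a → x ∈ {x | ∀ j, x i ≤ x j}ᶜ} := by
    ext x
    simp only [Set.mem_preimage, Set.mem_singleton_iff, Set.mem_inter_iff, Set.mem_ofPred_eq,
      Set.mem_compl_iff]
    constructor
    · rintro rfl
      refine ⟨argmin_le x, fun i hi hmin => hi.not_ge ?_⟩
      exact Finset.min'_le _ _ (by simpa using hmin)
    · rintro ⟨h1, h2⟩
      refine le_antisymm (Finset.min'_le _ _ (by simpa using h1)) ?_
      by_contra hlt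
      exact h2 _ (not_le.mp hlt) (argmin_le x)
  rw [h]
  refine MeasurableSet.inter ?_ ?_
  · simp only [Set.ofPred_forall]
    exact MeasurableSet.iInter fun j => measurableSet_le (by fun_prop) (by fun_prop)
  · simp only [Set.ofPred_forall]
    refine MeasurableSet.iInter fun i => MeasurableSet.iInter fun _ => ?_
    refine MeasurableSet.compl ?_
    exact MeasurableSet.iInter fun j => measurableSet_le (by fun_prop) (by fun_prop)

/-- The index minimizing `w i * exp (-φ i)`. -/
noncomputable def tiltedArgmin {C : ℕ} [NeZero C] (φ w : Fin C → ℝ) : Fin C :=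
  argmin fun i => w i * Real.exp (-φ i)

lemma measurable_tiltedArgmin {C : ℕ} [NeZero C] (φ : Fin C → ℝ) :
    Measurable (tiltedArgmin φ) :=
  measurable_argmin.comp (by fun_prop)

lemma tiltedArgmin_simplexProj {C : ℕ} [NeZero C] (φ : Fin C → ℝ) {x : Fin C → ℝ}
    (hx : 0 < ∑ i, x i) : tiltedArgmin φ (simplexProj x) = tiltedArgmin φ x := by
  unfold tiltedArgmin simplexProj
  simp only [Pi.smul_apply, smul_eq_mul, mul_assoc]
  exact argmin_smul _ (inv_pos.mpr hx)

lemma tiltedArgmin_of_mem {C : ℕ} [NeZero C] {φ : Fin C → ℝ} {a : Fin C} {x : Fin C → ℝ}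
    (hx : x ∈ strictArgminSet φ a) : tiltedArgmin φ x = a :=
  argmin_eq_of_forall_lt hx

/-- Splitting the exponential law along the value of the argmin. -/
lemma integral_tiltedArgmin_mul {C : ℕ} [NeZero C] (φ : Fin C → ℝ) (q : Fin C → ℝ)
    {h : (Fin C → ℝ) → ℝ} (hm : Measurable h) (hi : Integrable h (expOrthant C)) :
    ∫ x, q (tiltedArgmin φ x) * h x ∂(expOrthant C) =
      ∑ a, q a * (softmax φ a * ∫ x, h (shrinkMap φ a x) ∂(expOrthant C)) := by
  have hU := Measure.restrict_eq_self_of_ae_mem (expOrthant_ae_mem_iUnion_strictArgminSet φ)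
  have hset : ∀ a, ∀ᵐ x ∂((expOrthant C).restrict (strictArgminSet φ a)),
      q (tiltedArgmin φ x) * h x = q a * h x := by
    intro a
    filter_upwards [ae_restrict_mem (measurableSet_strictArgminSet φ a)] with x hx
    rw [tiltedArgmin_of_mem hx]
  rw [← hU, integral_iUnion_fintype (measurableSet_strictArgminSet φ)
    (pairwise_disjoint_strictArgminSet φ), hU]
  · refine Finset.sum_congr rfl fun a _ => ?_
    rw [integral_congr_ae (hset a), integral_const_mul, restrict_strictArgminSet,
      integral_smul_measure, integral_map (measurable_shrinkMap φ a).aemeasurable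
        hm.aestronglyMeasurable, ENNReal.toReal_ofReal (softmax_nonneg _ _), smul_eq_mul]
  · intro a
    exact ((hi.integrableOn (s := strictArgminSet φ a)).const_mul (q a)).congr
      ((hset a).mono fun x hx => hx.symm)

/-! ### Swaps, and unbiasedness of the ARS and ARSM weights -/

/-- A swap of coordinates preserves Lebesgue measure, the orthant and the coordinate sum. -/
lemma measurePreserving_comp_swap {C : ℕ} (m j : Fin C) :
    MeasurePreserving (fun x : Fin C → ℝ => swapEntries x m j) (expOrthant C) (expOrthant C) := by
  have hm : Measurable (fun x : Fin C → ℝ => swapEntries x m j) := by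
    unfold swapEntries; fun_prop
  have hv : MeasurePreserving (fun x : Fin C → ℝ => swapEntries x m j) volume volume := by
    have h := volume_measurePreserving_piCongrLeft (fun _ : Fin C => ℝ) (Equiv.swap m j)
    convert h using 1
    ext x i
    obtain ⟨k, rfl⟩ := (Equiv.swap m j).surjective i
    rw [MeasurableEquiv.coe_piCongrLeft, Equiv.piCongrLeft_apply_apply]
    simp [swapEntries]
  refine ⟨hm, Measure.ext_of_lintegral _ fun F hF => ?_⟩
  have hFs : Measurable fun x : Fin C → ℝ => F (swapEntries x m j) := hF.comp hm
  have hG : Measurable ({x : Fin C → ℝ | ∀ i, 0 < x i}.indicator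
      fun x => ENNReal.ofReal (Real.exp (-∑ i, x i)) * F x) :=
    Measurable.indicator (Measurable.mul (by fun_prop) hF) (measurableSet_pos_orthant C)
  rw [lintegral_map hF hm, lintegral_expOrthant hFs, lintegral_expOrthant hF,
    ← hv.lintegral_comp hG]
  refine lintegral_congr fun x => ?_
  have hsum : ∑ i, swapEntries x m j i = ∑ i, x i := Equiv.sum_comp (Equiv.swap m j) x
  have hpos : (∀ i, 0 < swapEntries x m j i) ↔ ∀ i, 0 < x i :=
    ⟨fun h i => by simpa [swapEntries] using h (Equiv.swap m j i), fun h i => h _⟩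
  by_cases hx : ∀ i, 0 < x i
  · rw [Set.indicator_of_mem (show x ∈ {x : Fin C → ℝ | ∀ i, 0 < x i} from hx),
      Set.indicator_of_mem (show swapEntries x m j ∈ {x : Fin C → ℝ | ∀ i, 0 < x i} from
        hpos.mpr hx), hsum]
  · rw [Set.indicator_of_notMem (show x ∉ {x : Fin C → ℝ | ∀ i, 0 < x i} from hx),
      Set.indicator_of_notMem (show swapEntries x m j ∉ {x : Fin C → ℝ | ∀ i, 0 < x i} from
        fun h => hx (hpos.mp h))]

lemma simplexProj_swapEntries {C : ℕ} (x : Fin C → ℝ) (m j : Fin C) :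
    simplexProj (swapEntries x m j) = swapEntries (simplexProj x) m j := by
  have hsum : ∑ i, swapEntries x m j i = ∑ i, x i := Equiv.sum_comp (Equiv.swap m j) x
  ext i
  simp only [simplexProj, hsum]
  rfl

section Simplex

variable {C : ℕ} [NeZero C]

lemma sum_pos_of_pos {x : Fin C → ℝ} (hx : ∀ i, 0 < x i) : 0 < ∑ i, x i :=
  Finset.sum_pos (fun i _ => hx i) Finset.univ_nonempty

lemma simplexProj_nonneg {x : Fin C → ℝ} (hx : ∀ i, 0 < x i) (c : Fin C) :
    0 ≤ simplexProj x c :=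
  mul_nonneg (inv_nonneg.mpr (sum_pos_of_pos hx).le) (hx c).le

lemma sum_simplexProj {x : Fin C → ℝ} (hx : ∀ i, 0 < x i) : ∑ c, simplexProj x c = 1 := by
  simp only [simplexProj, Pi.smul_apply, smul_eq_mul, ← Finset.mul_sum]
  exact inv_mul_cancel₀ (sum_pos_of_pos hx).ne'

lemma simplexProj_le_one {x : Fin C → ℝ} (hx : ∀ i, 0 < x i) (c : Fin C) :
    simplexProj x c ≤ 1 := by
  rw [← sum_simplexProj hx]
  exact Finset.single_le_sum (fun i _ => simplexProj_nonneg hx i) (Finset.mem_univ c)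

lemma integrable_simplexProj (c : Fin C) :
    Integrable (fun x => simplexProj x c) (expOrthant C) := by
  refine Integrable.of_bound
    ((measurable_pi_apply c).comp measurable_simplexProj).aestronglyMeasurable 1 ?_
  filter_upwards [expOrthant_ae_pos C] with x hx
  rw [Real.norm_eq_abs, abs_of_nonneg (simplexProj_nonneg hx c)]
  exact simplexProj_le_one hx c

/-- The coordinates are exchangeable and sum to one. -/
lemma integral_simplexProj (c : Fin C) :
    ∫ x, simplexProj x c ∂(expOrthant C) = 1 / C := by
  have h1 : ∀ i, ∫ x, simplexProj x i ∂(expOrthant C) = ∫ x, simplexProj x c ∂(expOrthant C) := by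
    intro i
    have hp := measurePreserving_comp_swap i c
    have hf : AEStronglyMeasurable (fun x : Fin C → ℝ => simplexProj x i)
        ((expOrthant C).map fun x => swapEntries x i c) :=
      ((measurable_pi_apply i).comp measurable_simplexProj).aestronglyMeasurable
    conv_lhs => rw [← hp.map_eq, integral_map hp.measurable.aemeasurable hf]
    refine integral_congr_ae (Filter.Eventually.of_forall fun x => ?_)
    simp [simplexProj_swapEntries, swapEntries]
  have h2 : ∫ x, ∑ i, simplexProj x i ∂(expOrthant C) = 1 := by
    rw [integral_congr_ae (g := fun _ => (1 : ℝ))]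
    · simp
    · filter_upwards [expOrthant_ae_pos C] with x hx
      exact sum_simplexProj hx
  rw [integral_finsetSum _ fun i _ => integrable_simplexProj i,
    Finset.sum_congr rfl fun i _ => h1 i] at h2
  simp only [Finset.sum_const, Finset.card_univ, Fintype.card_fin, nsmul_eq_mul] at h2
  rw [eq_div_iff (Nat.cast_ne_zero.mpr (NeZero.ne C)), mul_comm]
  exact h2

lemma simplexProj_shrinkMap (φ : Fin C → ℝ) (a c : Fin C) (x : Fin C → ℝ) :
    simplexProj (shrinkMap φ a x) c =
      simplexProj x c + simplexProj x a * (softmax φ c - if c = a then 1 else 0) := by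
  simp only [simplexProj, Pi.smul_apply, smul_eq_mul, sum_shrinkMap]
  rw [shrinkMap_apply]
  ring

instance : IsProbabilityMeasure (dirichlet C (fun _ => 1)) := by
  rw [dirichlet_one_eq_map_simplexProj]
  exact Measure.isProbabilityMeasure_map measurable_simplexProj.aemeasurable

lemma dirichlet_ae_mem_Icc (c : Fin C) :
    ∀ᵐ w ∂(dirichlet C (fun _ => 1)), w c ∈ Set.Icc (0 : ℝ) 1 := by
  rw [dirichlet_one_eq_map_simplexProj,
    ae_map_iff measurable_simplexProj.aemeasurable (measurable_pi_apply c measurableSet_Icc)]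
  filter_upwards [expOrthant_ae_pos C] with x hx
  exact ⟨simplexProj_nonneg hx c, simplexProj_le_one hx c⟩

lemma measurePreserving_swapEntries_dirichlet (m j : Fin C) :
    MeasurePreserving (fun w : Fin C → ℝ => swapEntries w m j) (dirichlet C (fun _ => 1))
      (dirichlet C (fun _ => 1)) := by
  have hm : Measurable (fun x : Fin C → ℝ => swapEntries x m j) := by
    unfold swapEntries; fun_prop
  refine ⟨hm, ?_⟩
  rw [dirichlet_one_eq_map_simplexProj, Measure.map_map hm measurable_simplexProj]
  have h : (fun x : Fin C → ℝ => swapEntries x m j) ∘ simplexProj =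
      simplexProj ∘ fun x => swapEntries x m j := by
    funext x
    exact (simplexProj_swapEntries x m j).symm
  rw [h, ← Measure.map_map measurable_simplexProj hm, (measurePreserving_comp_swap m j).map_eq]

/-- The argmin of `w i * exp (-φ i)` has the categorical law with logits `φ`. -/
lemma dirichlet_map_tiltedArgmin (φ : Fin C → ℝ) :
    (dirichlet C (fun _ => 1)).map (tiltedArgmin φ) = catSoftmax φ := by
  have h0 : (dirichlet C (fun _ => 1)).map (tiltedArgmin φ) =
      (expOrthant C).map (tiltedArgmin φ) := by
    rw [dirichlet_one_eq_map_simplexProj,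
      Measure.map_map (measurable_tiltedArgmin φ) measurable_simplexProj]
    refine Measure.map_congr ?_
    filter_upwards [expOrthant_ae_pos C] with x hx
    exact tiltedArgmin_simplexProj φ (sum_pos_of_pos hx)
  rw [h0]
  refine Measure.ext_of_singleton fun a => ?_
  rw [Measure.map_apply (measurable_tiltedArgmin φ) (measurableSet_singleton a)]
  have h1 : tiltedArgmin φ ⁻¹' {a} =ᵐ[expOrthant C] strictArgminSet φ a := by
    filter_upwards [expOrthant_ae_mem_iUnion_strictArgminSet φ] with x hx
    obtain ⟨b, hb⟩ := Set.mem_iUnion.mp hx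
    refine propext ⟨fun h => ?_, fun h => tiltedArgmin_of_mem h⟩
    have : b = a := (tiltedArgmin_of_mem hb).symm.trans h
    rwa [← this]
  rw [measure_congr h1, expOrthant_strictArgminSet]
  simp [catSoftmax, Measure.dirac_apply' _ (measurableSet_singleton a), Set.indicator_apply]

/-- On the cell of `a`, `w c` is replaced by `w c + w a * (softmax φ c - 1_{c=a})`, so `1 - C * w c`
has conditional mean `1_{c=a} - softmax φ c`; this is then averaged over `a` with weights `softmax φ
a`. The result is the derivative of `∑ a, softmax φ a * q a` in `φ c`. -/
lemma integral_dirichlet_tiltedArgmin_mul (φ q : Fin C → ℝ) (c : Fin C) :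
    ∫ w, q (tiltedArgmin φ w) * (1 - C * w c) ∂(dirichlet C (fun _ => 1)) =
      softmax φ c * q c - softmax φ c * ∑ a, softmax φ a * q a := by
  have hC : (C : ℝ) ≠ 0 := Nat.cast_ne_zero.mpr (NeZero.ne C)
  have hq : Measurable fun w => q (tiltedArgmin φ w) :=
    (measurable_from_top (f := q)).comp (measurable_tiltedArgmin φ)
  have hmeas : Measurable fun w : Fin C → ℝ => q (tiltedArgmin φ w) * (1 - C * w c) :=
    hq.mul (by fun_prop)
  have hsc : Measurable fun x : Fin C → ℝ => simplexProj x c :=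
    (measurable_pi_apply c).comp measurable_simplexProj
  have h1 : Measurable fun x : Fin C → ℝ => 1 - C * simplexProj x c := by fun_prop
  rw [dirichlet_one_eq_map_simplexProj, integral_map measurable_simplexProj.aemeasurable
    hmeas.aestronglyMeasurable]
  have h2 : ∫ x, q (tiltedArgmin φ (simplexProj x)) * (1 - C * simplexProj x c) ∂(expOrthant C) =
      ∫ x, q (tiltedArgmin φ x) * (1 - C * simplexProj x c) ∂(expOrthant C) := by
    refine integral_congr_ae ?_
    filter_upwards [expOrthant_ae_pos C] with x hx
    rw [tiltedArgmin_simplexProj φ (sum_pos_of_pos hx)]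
  have hint : ∀ i, Integrable (fun x => (C : ℝ) * simplexProj x i) (expOrthant C) :=
    fun i => (integrable_simplexProj i).const_mul _
  rw [h2, integral_tiltedArgmin_mul φ q h1 ((integrable_const _).sub (hint c))]
  have h3 : ∀ a, ∫ x, (1 - C * simplexProj (shrinkMap φ a x) c) ∂(expOrthant C) =
      (if c = a then 1 else 0) - softmax φ c := by
    intro a
    have h4 : ∀ x : Fin C → ℝ, 1 - C * simplexProj (shrinkMap φ a x) c =
        1 - (C * simplexProj x c +
          (C * simplexProj x a) * (softmax φ c - if c = a then 1 else 0)) := by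
      intro x
      rw [simplexProj_shrinkMap]
      ring
    simp only [h4]
    have hi : Integrable (fun x => C * simplexProj x c +
        (C * simplexProj x a) * (softmax φ c - if c = a then 1 else 0)) (expOrthant C) :=
      (hint c).add ((hint a).mul_const _)
    rw [integral_sub (integrable_const _) hi, integral_add (hint c) ((hint a).mul_const _),
      integral_mul_const, integral_const_mul,
      integral_const_mul, integral_simplexProj, integral_simplexProj]
    simp only [integral_const, probReal_univ, smul_eq_mul, mul_one]
    field_simp
    ring
  simp only [h3, mul_sub, Finset.sum_sub_distrib, Finset.mul_sum]
  simp
  rw [mul_comm]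
  congr 1
  exact Finset.sum_congr rfl fun a _ => by ring

/-- The pseudo action is the tilted argmin of the swapped vector, whose entry `c` is `w j`. The
invariant swap thus moves every `c` to the common factor `1 - C * w j`. -/
lemma integral_dirichlet_pseudoAction_mul (φ q : Fin C → ℝ) (c j : Fin C) :
    ∫ w, q (pseudoAction φ w c j) * (1 - C * w j) ∂(dirichlet C (fun _ => 1)) =
      softmax φ c * q c - softmax φ c * ∑ a, softmax φ a * q a := by
  have hp := measurePreserving_swapEntries_dirichlet c j
  have hq : Measurable fun w => q (tiltedArgmin φ w) :=
    (measurable_from_top (f := q)).comp (measurable_tiltedArgmin φ)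
  have hmeas : Measurable fun w : Fin C → ℝ => q (tiltedArgmin φ w) * (1 - C * w c) :=
    hq.mul (by fun_prop)
  rw [← integral_dirichlet_tiltedArgmin_mul, ← hp.map_eq,
    integral_map hp.measurable.aemeasurable hmeas.aestronglyMeasurable, hp.map_eq]
  refine integral_congr_ae (Filter.Eventually.of_forall fun w => ?_)
  simp [pseudoAction, tiltedArgmin, swapEntries]

lemma Measurable.pseudoAction {X : Type*} [MeasurableSpace X] {φ w : X → Fin C → ℝ}
    {j : X → Fin C} (hφ : Measurable φ) (hw : Measurable w) (hj : Measurable j) (c : Fin C) :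
    Measurable fun x => pseudoAction (φ x) (w x) c (j x) := by
  have h : ∀ i, Measurable fun p : Fin C × (Fin C → ℝ) => swapEntries p.2 c p.1 i := fun i =>
    measurable_from_prod_countable_right fun j => measurable_pi_apply (Equiv.swap c j i)
  have hi : ∀ i, Measurable fun x => swapEntries (w x) c (j x) i * Real.exp (-φ x i) := fun i =>
    ((h i).comp (hj.prodMk hw)).mul (by fun_prop)
  exact measurable_argmin.comp (measurable_pi_lambda _ hi)

lemma measurable_pseudoAction_apply (φ : Fin C → ℝ) (c j : Fin C) :
    Measurable fun w => pseudoAction φ w c j :=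
  (measurable_tiltedArgmin φ).comp (measurePreserving_swapEntries_dirichlet c j).measurable

lemma dirichlet_map_pseudoAction (φ : Fin C → ℝ) (c j : Fin C) :
    (dirichlet C (fun _ => 1)).map (fun w => pseudoAction φ w c j) = catSoftmax φ := by
  have hp := measurePreserving_swapEntries_dirichlet c j
  rw [← dirichlet_map_tiltedArgmin φ]
  conv_rhs => rw [← hp.map_eq, Measure.map_map (measurable_tiltedArgmin φ) hp.measurable]
  rfl

lemma lintegral_dirichlet_pseudoAction (φ : Fin C → ℝ) (f : Fin C → ℝ≥0∞) (c j : Fin C) :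
    ∫⁻ w, f (pseudoAction φ w c j) ∂(dirichlet C (fun _ => 1)) =
      ∑ a, ENNReal.ofReal (softmax φ a) * f a := by
  rw [← lintegral_catSoftmax, ← dirichlet_map_pseudoAction φ c j,
    lintegral_map (measurable_from_top) (measurable_pseudoAction_apply φ c j)]

lemma measurable_gARS (q φ : Fin C → ℝ) (j c : Fin C) : Measurable fun w => gARS q φ w j c := by
  have hq : ∀ m, Measurable fun w => q (pseudoAction φ w m j) := fun m =>
    (measurable_from_top (f := q)).comp (measurable_pseudoAction_apply φ m j)
  unfold gARS fDelta
  exact ((hq c).sub (measurable_const.mul (Finset.measurable_sum _ fun m _ => hq m))).mul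
    (by fun_prop)

/-- Each pseudo action has law `catSoftmax φ`, `|1 - C * w j| ≤ C` on the simplex, and `1 / C ≤ 1`:
there are `1 + C` terms, each times `C`. The bound uses the policy average of `|q|`, the quantity
that is integrable over states when `Q` is unbounded. -/
lemma lintegral_enorm_gARS_le (q φ : Fin C → ℝ) (j c : Fin C) :
    ∫⁻ w, ‖gARS q φ w j c‖ₑ ∂(dirichlet C (fun _ => 1)) ≤
      (1 + C) * C * ∑ a, ENNReal.ofReal (softmax φ a) * ‖q a‖ₑ := by
  have hC : (1 : ℝ) ≤ C := Nat.one_le_cast.mpr (NeZero.one_le)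
  have hq : ∀ m, Measurable fun w => ‖q (pseudoAction φ w m j)‖ₑ := fun m =>
    (measurable_from_top (f := fun a => ‖q a‖ₑ)).comp (measurable_pseudoAction_apply φ m j)
  have hle : ∀ᵐ w ∂(dirichlet C (fun _ => 1)), ‖gARS q φ w j c‖ₑ ≤
      (‖q (pseudoAction φ w c j)‖ₑ + ∑ m, ‖q (pseudoAction φ w m j)‖ₑ) * C := by
    filter_upwards [dirichlet_ae_mem_Icc j] with w hw
    have h1 : |1 - C * w j| ≤ C := by
      rw [abs_le]
      constructor <;> nlinarith [hw.1, hw.2]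
    have h2 : |gARS q φ w j c| ≤
        (|q (pseudoAction φ w c j)| + ∑ m, |q (pseudoAction φ w m j)|) * C := by
      rw [gARS, abs_mul]
      refine mul_le_mul ?_ h1 (abs_nonneg _) (by positivity)
      refine (abs_sub _ _).trans (add_le_add le_rfl ?_)
      rw [abs_mul, abs_of_nonneg (by positivity)]
      refine (mul_le_of_le_one_left (abs_nonneg _) ?_).trans (Finset.abs_sum_le_sum_abs _ _)
      exact (div_le_one (by positivity)).mpr hC
    simp only [← ofReal_norm, Real.norm_eq_abs]
    rw [← ENNReal.ofReal_sum_of_nonneg fun _ _ => abs_nonneg _,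
      ← ENNReal.ofReal_add (abs_nonneg _) (by positivity), ← ENNReal.ofReal_natCast C,
      ← ENNReal.ofReal_mul (by positivity)]
    exact ENNReal.ofReal_le_ofReal h2
  refine (lintegral_mono_ae hle).trans ?_
  rw [lintegral_mul_const' _ _ (by simp),
    lintegral_add_left (hq c), lintegral_finsetSum _ fun m _ => hq m]
  simp only [lintegral_dirichlet_pseudoAction φ (fun a => ‖q a‖ₑ), Finset.sum_const,
    Finset.card_univ, Fintype.card_fin, nsmul_eq_mul]
  rw [add_mul, add_mul, add_mul, one_mul, mul_comm _ (C : ℝ≥0∞), mul_right_comm]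

lemma integrable_gARS (q φ : Fin C → ℝ) (j c : Fin C) :
    Integrable (fun w => gARS q φ w j c) (dirichlet C (fun _ => 1)) := by
  refine ⟨(measurable_gARS q φ j c).aestronglyMeasurable, ?_⟩
  refine (lintegral_enorm_gARS_le q φ j c).trans_lt ?_
  refine ENNReal.mul_lt_top (ENNReal.mul_lt_top (by simp) (by simp)) ?_
  exact ENNReal.sum_lt_top.mpr fun a _ =>
    ENNReal.mul_lt_top ENNReal.ofReal_lt_top enorm_lt_top

/-- The ARS weights are unbiased estimators of the derivatives of `∑ a, softmax φ a * q a`. -/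
lemma integral_gARS (q φ : Fin C → ℝ) (j c : Fin C) :
    ∫ w, gARS q φ w j c ∂(dirichlet C (fun _ => 1)) =
      softmax φ c * q c - softmax φ c * ∑ a, softmax φ a * q a := by
  have hi : ∀ m, Integrable (fun w : Fin C → ℝ => q (pseudoAction φ w m j) * (1 - C * w j))
      (dirichlet C (fun _ => 1)) := by
    intro m
    refine Integrable.of_bound (C := (∑ a, |q a|) * (1 + C)) ?_ ?_
    · exact (((measurable_from_top (f := q)).comp (measurable_pseudoAction_apply φ m j)).mul
        (by fun_prop)).aestronglyMeasurable
    · filter_upwards [dirichlet_ae_mem_Icc j] with w hw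
      rw [norm_mul]
      refine mul_le_mul ?_ ?_ (norm_nonneg _) (Finset.sum_nonneg fun _ _ => abs_nonneg _)
      · exact Finset.single_le_sum (f := fun a => |q a|) (fun a _ => abs_nonneg _)
          (Finset.mem_univ _)
      · have hC : (0 : ℝ) ≤ C := Nat.cast_nonneg _
        rw [Real.norm_eq_abs, abs_le]
        constructor <;> nlinarith [hw.1, hw.2]
  have h : ∀ w, gARS q φ w j c = q (pseudoAction φ w c j) * (1 - C * w j) -
      1 / (C : ℝ) * ∑ m, q (pseudoAction φ w m j) * (1 - C * w j) := by
    intro w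
    rw [gARS, fDelta, sub_mul, mul_assoc, Finset.sum_mul]
  simp only [h]
  rw [integral_sub (hi c) ((integrable_finsetSum _ fun m _ => hi m).const_mul _),
    integral_const_mul, integral_finsetSum _ fun m _ => hi m]
  simp only [integral_dirichlet_pseudoAction_mul, Finset.sum_sub_distrib]
  -- The baseline has mean zero: `∑ m, (σ_m q_m - σ_m ∑ a, σ_a q_a) = 0` since `∑ m, σ_m = 1`.
  rw [← Finset.sum_mul, sum_softmax]
  simp

/-- Because `1/C - w j = (1/C) (1 - C w j)`, ARSM averages ARS over a uniform reference category. -/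
lemma gARSM_eq (q φ w : Fin C → ℝ) (c : Fin C) :
    gARSM q φ w c = ∑ j, 1 / (C : ℝ) * gARS q φ w j c := by
  have hC : (C : ℝ) ≠ 0 := Nat.cast_ne_zero.mpr (NeZero.ne C)
  refine Finset.sum_congr rfl fun j _ => ?_
  rw [gARS]
  field_simp

end Simplex

/-! ### Differentiation under the integral with bounded integrals only -/

lemma abs_exp_sub_one_le_mul_exp_abs (x : ℝ) : |Real.exp x - 1| ≤ |x| * Real.exp |x| := by
  have h1 := Real.add_one_le_exp x
  have h2 := Real.add_one_le_exp (-x)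
  have h3 : Real.exp x * Real.exp (-x) = 1 := by rw [← Real.exp_add, add_neg_cancel, Real.exp_zero]
  have h4 := Real.exp_pos x
  rcases le_total 0 x with hx | hx
  · rw [abs_of_nonneg hx, abs_of_nonneg (by linarith)]
    nlinarith
  · rw [abs_of_nonpos hx, abs_of_nonpos (by linarith [Real.exp_le_one_iff.mpr hx])]
    nlinarith [Real.one_le_exp (neg_nonneg.mpr hx)]

lemma HasFDerivAt.tendsto_norm_inv_mul {E : Type*} [NormedAddCommGroup E] [NormedSpace ℝ E]
    {g : E → ℝ} {g' : E →L[ℝ] ℝ} {θ : E} (h : HasFDerivAt g g' θ) :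
    Filter.Tendsto (fun y => ‖y - θ‖⁻¹ * |g y - g θ - g' (y - θ)|) (nhds θ) (nhds 0) :=
  hasFDerivAt_iff_tendsto.mp h

section DerivIntegral

variable {E : Type*} [NormedAddCommGroup E] [InnerProductSpace ℝ E] [CompleteSpace E]
  {X : Type*} [MeasurableSpace X] {μ : Measure X}

/-- Differentiation of `θ' ↦ ∫ f x * exp (l θ' x)` when only the integrals of
`|f x| * (1 + K x) * exp (l θ' x)`, and not their integrands, are dominated uniformly near `θ`. -/
theorem hasGradientAt_integral_mul_exp {f K : X → ℝ} {l : E → X → ℝ} {D : X → E} {θ : E} {ε : ℝ}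
    (hε : 0 < ε) (hf : Measurable f) (hK : Measurable K) (hK0 : ∀ x, 0 ≤ K x)
    (hl : ∀ y, Measurable (l y)) (hDm : AEStronglyMeasurable D μ)
    (hlK : ∀ y ∈ Metric.ball θ ε, ∀ x, |l y x| ≤ K x * ‖y - θ‖)
    {B : ℝ≥0} (hB : ∀ y ∈ Metric.ball θ ε,
      ∫⁻ x, ENNReal.ofReal (|f x| * (1 + K x) * Real.exp (l y x)) ∂μ ≤ B)
    (hD : ∀ᵐ x ∂μ, HasGradientAt (fun y => l y x) (D x) θ) :
    Integrable (fun x => f x • D x) μ ∧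
      HasGradientAt (fun y => ∫ x, f x * Real.exp (l y x) ∂μ) (∫ x, f x • D x ∂μ) θ := by
  have hball : ∀ᶠ y in nhds θ, y ∈ Metric.ball θ ε := Metric.ball_mem_nhds θ hε
  have hlθ : ∀ x, l θ x = 0 := fun x => by
    simpa using hlK θ (Metric.mem_ball_self hε) x
  have hint : ∀ y ∈ Metric.ball θ ε,
      Integrable (fun x => |f x| * (1 + K x) * Real.exp (l y x)) μ := by
    intro y hy
    have := hl y
    refine ⟨by fun_prop, ?_⟩
    rw [hasFiniteIntegral_iff_ofReal]
    · exact (hB y hy).trans_lt ENNReal.coe_lt_top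
    · refine Filter.Eventually.of_forall fun x => ?_
      have := hK0 x
      simp only [Pi.zero_apply]
      positivity
  have hintB : ∀ y ∈ Metric.ball θ ε, ∫ x, |f x| * (1 + K x) * Real.exp (l y x) ∂μ ≤ B := by
    intro y hy
    rw [integral_eq_lintegral_of_nonneg_ae _ (hint y hy).1]
    · exact ENNReal.toReal_le_coe_of_le_coe (hB y hy)
    · refine Filter.Eventually.of_forall fun x => ?_
      have := hK0 x
      simp only [Pi.zero_apply]
      positivity
  have hintK : ∀ y ∈ Metric.ball θ ε,
      Integrable (fun x => |f x| * K x * Real.exp (l y x)) μ := by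
    intro y hy
    have := hl y
    refine (hint y hy).mono' (by fun_prop) (Filter.Eventually.of_forall fun x => ?_)
    have := hK0 x
    rw [Real.norm_of_nonneg (by positivity)]
    gcongr
    linarith
  have hintf : ∀ y ∈ Metric.ball θ ε, Integrable (fun x => f x * Real.exp (l y x)) μ := by
    intro y hy
    have := hl y
    refine (hint y hy).mono' (by fun_prop) (Filter.Eventually.of_forall fun x => ?_)
    have := hK0 x
    rw [norm_mul, Real.norm_eq_abs, Real.norm_of_nonneg (Real.exp_pos _).le]
    gcongr
    exact le_mul_of_one_le_right (abs_nonneg _) (by linarith)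
  have hfK : Integrable (fun x => |f x| * K x) μ := by
    simpa [hlθ] using hintK θ (Metric.mem_ball_self hε)
  -- The Lipschitz constant of `l` at `θ` bounds its gradient.
  have hDK : ∀ᵐ x ∂μ, ‖D x‖ ≤ K x := by
    filter_upwards [hD] with x hx
    have h := hx.hasFDerivAt.le_of_lip' (hK0 x) (by
      filter_upwards [hball] with y hy
      rw [hlθ, sub_zero]
      exact hlK y hy x)
    simpa using h
  have hfD : Integrable (fun x => f x • D x) μ := by
    refine hfK.mono' (hf.aestronglyMeasurable.smul hDm) ?_
    filter_upwards [hDK] with x hx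
    rw [norm_smul, Real.norm_eq_abs]
    gcongr
  refine ⟨hfD, ?_⟩
  -- The normalised first-order remainder of the integrand; its integral must tend to zero.
  set q : E → X → ℝ := fun y x =>
    ‖y - θ‖⁻¹ * (|f x| * |Real.exp (l y x) - 1 - inner ℝ (D x) (y - θ)|) with hq
  have hqm : ∀ y, AEStronglyMeasurable (q y) μ := by
    intro y
    have h1 : AEStronglyMeasurable (fun x => inner ℝ (D x) (y - θ)) μ :=
      hDm.inner aestronglyMeasurable_const
    have h2 : AEStronglyMeasurable (fun x => Real.exp (l y x) - 1 - inner ℝ (D x) (y - θ)) μ :=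
      ((hl y).exp.sub measurable_const).aestronglyMeasurable.sub h1
    exact (hf.norm.aestronglyMeasurable.mul h2.norm).const_mul _
  have hq0 : ∀ y x, 0 ≤ q y x := fun y x => by positivity
  have hqlim : ∀ᵐ x ∂μ, Filter.Tendsto (fun y => q y x) (nhds θ) (nhds 0) := by
    filter_upwards [hD] with x hx
    have h1 : HasFDerivAt (fun y => Real.exp (l y x)) (InnerProductSpace.toDual ℝ E (D x)) θ := by
      have := hx.hasFDerivAt.exp
      rwa [hlθ, Real.exp_zero, one_smul] at this
    have h2 := (h1.tendsto_norm_inv_mul).const_mul |f x|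
    rw [mul_zero] at h2
    refine h2.congr fun y => ?_
    simp only [hq, hlθ, Real.exp_zero, InnerProductSpace.toDual_apply_apply]
    ring
  -- The remainder is cut at level `A`. The subtracted term has integral at most `B / A` uniformly
  -- in `y`, while for fixed `A` the rest is dominated by an integrable function independent of `y`,
  -- so dominated convergence applies to it.
  set p : ℝ → E → X → ℝ := fun A y x => max 0 (q y x - |f x| * K x * Real.exp (l y x) / A) with hp
  have hpbound : ∀ A, 1 ≤ A → ∀ y ∈ Metric.ball θ ε, ∀ᵐ x ∂μ,
      ‖p A y x‖ ≤ |f x| * K x * (Real.exp A + 2) := by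
    intro A hA y hy
    filter_upwards [hDK] with x hx
    have hKx := hK0 x
    rw [Real.norm_of_nonneg (le_max_left _ _)]
    refine max_le (by positivity) ?_
    rcases eq_or_lt_of_le (norm_nonneg (y - θ)) with h0 | h0
    · simp only [hq, ← h0, inv_zero, zero_mul, zero_sub]
      have : 0 ≤ |f x| * K x * Real.exp (l y x) / A := by positivity
      have : 0 ≤ |f x| * K x * (Real.exp A + 2) := by positivity
      linarith
    have hin : |inner ℝ (D x) (y - θ)| ≤ K x * ‖y - θ‖ :=
      (abs_real_inner_le_norm _ _).trans (by gcongr)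
    have hl' := hlK y hy x
    set r := ‖y - θ‖ with hr
    have hsplit : q y x ≤ |f x| * (r⁻¹ * |Real.exp (l y x) - 1|) + |f x| * K x := by
      have h1 : r⁻¹ * |Real.exp (l y x) - 1 - inner ℝ (D x) (y - θ)| ≤
          r⁻¹ * |Real.exp (l y x) - 1| + K x := by
        calc _ ≤ r⁻¹ * (|Real.exp (l y x) - 1| + K x * r) := by
              gcongr
              exact (abs_sub _ _).trans (add_le_add le_rfl hin)
          _ = _ := by field_simp
      calc q y x = |f x| * (r⁻¹ * |Real.exp (l y x) - 1 - inner ℝ (D x) (y - θ)|) := by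
            simp only [hq]; ring
        _ ≤ |f x| * (r⁻¹ * |Real.exp (l y x) - 1| + K x) := by gcongr
        _ = _ := by ring
    -- If `K r ≤ A`, then `|l| ≤ A` and the quotient is at most `K exp A`. Otherwise `r⁻¹ ≤ K / A`,
    -- and the part containing `exp l` is exactly what `p` subtracts.
    rcases le_or_gt (K x * r) A with hKr | hKr
    · have h1 : r⁻¹ * |Real.exp (l y x) - 1| ≤ K x * Real.exp A := by
        calc _ ≤ r⁻¹ * (K x * r * Real.exp A) := by
              gcongr
              refine (abs_exp_sub_one_le_mul_exp_abs _).trans ?_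
              gcongr
              exact hl'.trans hKr
          _ = _ := by field_simp
      have h2 : 0 ≤ |f x| * K x * Real.exp (l y x) / A := by positivity
      have h3 : |f x| * (r⁻¹ * |Real.exp (l y x) - 1|) ≤ |f x| * (K x * Real.exp A) := by gcongr
      have h4 : 0 ≤ |f x| * K x := by positivity
      linarith
    · have hA0 : 0 < A := by linarith
      have h1 : r⁻¹ ≤ K x / A := by
        rw [inv_le_iff_one_le_mul₀ h0, div_mul_eq_mul_div, le_div_iff₀ hA0]
        linarith
      have h2 : |Real.exp (l y x) - 1| ≤ Real.exp (l y x) + 1 := by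
        rw [abs_le]
        have := Real.exp_pos (l y x)
        constructor <;> linarith
      have h3 : r⁻¹ * |Real.exp (l y x) - 1| ≤ K x * Real.exp (l y x) / A + K x := by
        calc _ ≤ K x / A * (Real.exp (l y x) + 1) := by gcongr
          _ = K x * Real.exp (l y x) / A + K x / A := by ring
          _ ≤ _ := by
            gcongr
            exact div_le_self hKx hA
      have h4 : |f x| * (r⁻¹ * |Real.exp (l y x) - 1|) ≤
          |f x| * K x * Real.exp (l y x) / A + |f x| * K x := by
        calc _ ≤ |f x| * (K x * Real.exp (l y x) / A + K x) := by gcongr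
          _ = _ := by ring
      have h5 : 0 ≤ |f x| * K x * Real.exp A := by positivity
      linarith
  have hpm : ∀ A y, AEStronglyMeasurable (p A y) μ := by
    intro A y
    have := hl y
    have h1 : Measurable fun x => |f x| * K x * Real.exp (l y x) / A := by fun_prop
    exact aestronglyMeasurable_const.sup ((hqm y).sub h1.aestronglyMeasurable)
  have hpint : ∀ A, 1 ≤ A → ∀ y ∈ Metric.ball θ ε, Integrable (p A y) μ := fun A hA y hy =>
    (hfK.mul_const _).mono' (hpm A y) (hpbound A hA y hy)
  have hplim : ∀ A, 1 ≤ A →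
      Filter.Tendsto (fun y => ∫ x, p A y x ∂μ) (nhds θ) (nhds 0) := by
    intro A hA
    have h := tendsto_integral_filter_of_dominated_convergence (μ := μ) (l := nhds θ) (F := p A)
      (f := fun _ => (0 : ℝ)) (fun x => |f x| * K x * (Real.exp A + 2))
      (Filter.Eventually.of_forall (hpm A))
      (by filter_upwards [hball] with y hy using hpbound A hA y hy) (hfK.mul_const _) (by
        filter_upwards [hqlim] with x hx
        refine squeeze_zero (fun y => le_max_left _ _) (fun y => ?_) hx
        have := hK0 x
        refine max_le (hq0 y x) (sub_le_self _ (by positivity)))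
    simpa using h
  have hqp : ∀ A, 1 ≤ A → ∀ y ∈ Metric.ball θ ε, Integrable (q y) μ ∧
      ∫ x, q y x ∂μ ≤ ∫ x, p A y x ∂μ + B / A := by
    intro A hA y hy
    have hA0 : 0 < A := by linarith
    have hle : ∀ x, q y x ≤ p A y x + |f x| * K x * Real.exp (l y x) / A := fun x => by
      have := le_max_right 0 (q y x - |f x| * K x * Real.exp (l y x) / A)
      simp only [hp]
      linarith
    have hi := (hpint A hA y hy).add ((hintK y hy).div_const A)
    have hqi : Integrable (q y) μ := hi.mono' (hqm y)
      (Filter.Eventually.of_forall fun x => by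
        rw [Real.norm_of_nonneg (hq0 y x)]; exact hle x)
    refine ⟨hqi, (integral_mono hqi hi hle).trans ?_⟩
    simp only [Pi.add_apply]
    rw [integral_add (hpint A hA y hy) ((hintK y hy).div_const A), integral_div]
    gcongr
    refine (integral_mono (hintK y hy) (hint y hy) fun x => ?_).trans (hintB y hy)
    have := hK0 x
    simp only
    gcongr
    linarith
  have hqI : Filter.Tendsto (fun y => ∫ x, q y x ∂μ) (nhds θ) (nhds 0) := by
    refine Metric.tendsto_nhds.mpr fun δ hδ => ?_
    -- Chosen so that `A ≥ 1` and `B / A ≤ δ / 2`.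
    set A : ℝ := 1 + 2 * B / δ with hA
    have hA1 : 1 ≤ A := by
      have : 0 ≤ 2 * (B : ℝ) / δ := by positivity
      linarith
    have hBA : B / A ≤ δ / 2 := by
      rw [div_le_iff₀ (by linarith), hA]
      have : δ / 2 * (1 + 2 * B / δ) = δ / 2 + B := by field_simp
      linarith
    filter_upwards [hball, Metric.tendsto_nhds.mp (hplim A hA1) (δ / 2) (by linarith)] with y hy h2
    rw [Real.dist_eq, sub_zero] at h2 ⊢
    rw [abs_of_nonneg (integral_nonneg (hq0 y))]
    have := (hqp A hA1 y hy).2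
    have := le_abs_self (∫ x, p A y x ∂μ)
    linarith
  rw [hasGradientAt_iff_hasFDerivAt, hasFDerivAt_iff_tendsto]
  refine squeeze_zero' (Filter.Eventually.of_forall fun y => by positivity) ?_ hqI
  filter_upwards [hball] with y hy
  have hi : Integrable (fun x => f x * Real.exp (l y x) - f x * Real.exp (l θ x)) μ :=
    (hintf y hy).sub (hintf θ (Metric.mem_ball_self hε))
  have h1 : (∫ x, f x * Real.exp (l y x) ∂μ) - (∫ x, f x * Real.exp (l θ x) ∂μ) -
      (InnerProductSpace.toDual ℝ E (∫ x, f x • D x ∂μ)) (y - θ) =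
      ∫ x, f x * (Real.exp (l y x) - 1 - inner ℝ (D x) (y - θ)) ∂μ := by
    rw [InnerProductSpace.toDual_apply_apply, real_inner_comm, ← integral_inner hfD,
      ← integral_sub (hintf y hy) (hintf θ (Metric.mem_ball_self hε)), ← integral_sub
      hi (hfD.const_inner _)]
    refine integral_congr_ae (Filter.Eventually.of_forall fun x => ?_)
    simp only [hlθ, Real.exp_zero, inner_smul_right]
    rw [real_inner_comm]
    ring
  rw [h1]
  calc _ ≤ ‖y - θ‖⁻¹ * ∫ x, ‖f x * (Real.exp (l y x) - 1 - inner ℝ (D x) (y - θ))‖ ∂μ := by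
        gcongr
        exact norm_integral_le_integral_norm _
    _ = ∫ x, q y x ∂μ := by
        rw [← integral_const_mul]
        refine integral_congr_ae (Filter.Eventually.of_forall fun x => ?_)
        simp only [hq, norm_mul, Real.norm_eq_abs]

end DerivIntegral

/-! ### The logarithm of the softmax and its gradient -/

section LogSoftmax

variable {C : ℕ}

lemma log_softmax (φ : Fin C → ℝ) (a : Fin C) :
    Real.log (softmax φ a) = φ a - Real.log (∑ i, Real.exp (φ i)) := by
  rw [softmax, Real.log_div (Real.exp_pos _).ne'
    (Finset.sum_pos (fun _ _ => Real.exp_pos _) ⟨a, Finset.mem_univ _⟩).ne', Real.log_exp]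

lemma log_sum_exp_le [NeZero C] (φ' φ : Fin C → ℝ) :
    Real.log (∑ i, Real.exp (φ' i)) ≤ Real.log (∑ i, Real.exp (φ i)) + ‖φ' - φ‖ := by
  have hpos : ∀ φ : Fin C → ℝ, 0 < ∑ i, Real.exp (φ i) := fun φ =>
    Finset.sum_pos (fun _ _ => Real.exp_pos _) Finset.univ_nonempty
  rw [← Real.log_exp ‖φ' - φ‖, ← Real.log_mul (hpos φ).ne' (Real.exp_pos _).ne']
  refine Real.log_le_log (hpos φ') ?_
  rw [Finset.sum_mul]
  refine Finset.sum_le_sum fun i _ => ?_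
  rw [← Real.exp_add]
  refine Real.exp_le_exp.mpr ?_
  have h := norm_le_pi_norm (φ' - φ) i
  rw [Pi.sub_apply, Real.norm_eq_abs] at h
  have := le_abs_self (φ' i - φ i)
  linarith

/-- One unit of the constant comes from the logit, the other from log-sum-exp, which is 1-Lipschitz
for the maximum norm. -/
lemma abs_log_softmax_sub_le [NeZero C] (φ' φ : Fin C → ℝ) (a : Fin C) :
    |Real.log (softmax φ' a) - Real.log (softmax φ a)| ≤ 2 * ‖φ' - φ‖ := by
  have h := norm_le_pi_norm (φ' - φ) a
  rw [Pi.sub_apply, Real.norm_eq_abs] at h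
  have h1 := log_sum_exp_le φ' φ
  have h2 := log_sum_exp_le φ φ'
  rw [norm_sub_rev] at h2
  rw [log_softmax, log_softmax]
  have h3 := abs_le.mp h
  rw [abs_le]
  constructor <;> linarith [h3.1, h3.2]

/-- The gradient of the log-probability of an action, given the gradients of the logits. -/
noncomputable def scoreVector {E : Type*} [AddCommGroup E] [Module ℝ E] (φ : Fin C → ℝ)
    (G : Fin C → E) (a : Fin C) : E :=
  G a - ∑ c, softmax φ c • G c

lemma hasGradientAt_log_softmax {E : Type*} [NormedAddCommGroup E] [InnerProductSpace ℝ E]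
    [CompleteSpace E] {f : E → Fin C → ℝ} {G : Fin C → E} {θ : E}
    (h : ∀ c, HasGradientAt (fun y => f y c) (G c) θ) (a : Fin C) :
    HasGradientAt (fun y => Real.log (softmax (f y) a)) (scoreVector (f θ) G a) θ := by
  simp only [log_softmax]
  rw [hasGradientAt_iff_hasFDerivAt]
  have h1 : ∀ c, HasFDerivAt (fun y => f y c) (InnerProductSpace.toDual ℝ E (G c)) θ :=
    fun c => (h c).hasFDerivAt
  have hpos : 0 < ∑ i, Real.exp (f θ i) :=
    Finset.sum_pos (fun _ _ => Real.exp_pos _) ⟨a, Finset.mem_univ _⟩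
  have h2 := (h1 a).sub
    ((HasFDerivAt.fun_sum fun c (_ : c ∈ Finset.univ) => (h1 c).exp).log hpos.ne')
  have h3 : InnerProductSpace.toDual ℝ E (scoreVector (f θ) G a) =
      InnerProductSpace.toDual ℝ E (G a) - (∑ i, Real.exp (f θ i))⁻¹ •
        ∑ i, Real.exp (f θ i) • InnerProductSpace.toDual ℝ E (G i) := by
    rw [scoreVector, map_sub, map_sum, Finset.smul_sum]
    congr 1
    refine Finset.sum_congr rfl fun c _ => ?_
    rw [LinearIsometryEquiv.map_smulₛₗ, smul_smul, softmax, div_eq_inv_mul]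
    rfl
  rw [h3]
  exact h2

/-- Exchanging the two sums turns the mean of action value times score into the coefficients that
the ARS and ARSM weights estimate. -/
lemma sum_softmax_smul_scoreVector {E : Type*} [AddCommGroup E] [Module ℝ E] (φ q : Fin C → ℝ)
    (G : Fin C → E) :
    ∑ a, softmax φ a • q a • scoreVector φ G a =
      ∑ c, (softmax φ c * q c - softmax φ c * ∑ a, softmax φ a * q a) • G c := by
  simp only [scoreVector, smul_sub, sub_smul, Finset.sum_sub_distrib, smul_smul]
  congr 1
  simp only [Finset.smul_sum, smul_smul]
  rw [Finset.sum_comm]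
  refine Finset.sum_congr rfl fun c _ => ?_
  rw [← Finset.sum_smul, Finset.mul_sum]
  congr 1
  exact Finset.sum_congr rfl fun a _ => by ring

end LogSoftmax

/-! ### Measurable gradients, and Fubini for the estimators -/

/-- Each coordinate is an almost everywhere limit of difference quotients of step `1 / n`. -/
lemma aemeasurable_gradient {S : Type*} [MeasurableSpace S] {ρ : Measure S} {d : ℕ}
    {g : EuclideanSpace ℝ (Fin d) → S → ℝ} (hg : ∀ y, Measurable (g y))
    {θ : EuclideanSpace ℝ (Fin d)} (hd : ∀ᵐ s ∂ρ, DifferentiableAt ℝ (fun y => g y s) θ) :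
    AEMeasurable (fun s => gradient (fun y => g y s) θ) ρ := by
  have hcoord : ∀ i, AEMeasurable (fun s => gradient (fun y => g y s) θ i) ρ := by
    intro i
    refine aemeasurable_of_tendsto_metrizable_ae Filter.atTop
      (f := fun (n : ℕ) s => (n : ℝ) * (g (θ + (n : ℝ)⁻¹ • EuclideanSpace.single i 1) s - g θ s))
      (fun n => (measurable_const.mul ((hg _).sub (hg _))).aemeasurable) ?_
    filter_upwards [hd] with s hs
    have h0 := hs.hasGradientAt
    generalize gradient (fun y => g y s) θ = u at h0 ⊢
    have h := h0.hasFDerivAt.lim (EuclideanSpace.single i 1)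
      (c := fun n : ℕ => (n : ℝ)) (l := Filter.atTop)
      (by simpa using tendsto_natCast_atTop_atTop (R := ℝ))
    simpa [EuclideanSpace.inner_single_right] using h
  have h1 : AEMeasurable (fun s => (gradient (fun y => g y s) θ).ofLp) ρ :=
    aemeasurable_pi_iff.mpr hcoord
  exact (WithLp.measurable_toLp 2 (Fin d → ℝ)).comp_aemeasurable h1

/-- Differentiability holds only almost everywhere, so the gradient is replaced by a measurable
version. The Lipschitz bound passes to each coordinate because the norm on logits is the maximum
norm. -/
lemma exists_measurable_gradient {S : Type*} [MeasurableSpace S] {ρ : Measure S} {C d : ℕ}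
    {T : EuclideanSpace ℝ (Fin d) → S → Fin C → ℝ} (hT : ∀ y, Measurable (T y))
    {θ : EuclideanSpace ℝ (Fin d)} (hd : ∀ᵐ s ∂ρ, DifferentiableAt ℝ (fun y => T y s) θ)
    {ε : ℝ} (hε : 0 < ε) {L : S → ℝ≥0}
    (hLip : ∀ s, LipschitzOnWith (L s) (fun y => T y s) (Metric.ball θ ε)) :
    ∃ G : Fin C → S → EuclideanSpace ℝ (Fin d), (∀ c, Measurable (G c)) ∧
      ∀ᵐ s ∂ρ, ∀ c, HasGradientAt (fun y => T y s c) (G c s) θ ∧ ‖G c s‖ ≤ L s := by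
  have hdc : ∀ c, ∀ᵐ s ∂ρ, DifferentiableAt ℝ (fun y => T y s c) θ := fun c => by
    filter_upwards [hd] with s hs
    exact differentiableAt_pi.mp hs c
  have hm : ∀ c, AEMeasurable (fun s => gradient (fun y => T y s c) θ) ρ := fun c =>
    aemeasurable_gradient (fun y => (measurable_pi_apply c).comp (hT y)) (hdc c)
  refine ⟨fun c => (hm c).mk _, fun c => (hm c).measurable_mk, ?_⟩
  refine ae_all_iff.mpr fun c => ?_
  filter_upwards [hdc c, (hm c).ae_eq_mk] with s h1 h2
  rw [← h2]
  have h0 := h1.hasGradientAt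
  generalize gradient (fun y => T y s c) θ = u at h0 ⊢
  refine ⟨h0, ?_⟩
  have h := h0.hasFDerivAt.le_of_lip' (C := L s) (NNReal.coe_nonneg _) (by
    filter_upwards [Metric.ball_mem_nhds θ hε] with y hy
    have h3 := (hLip s).norm_sub_le hy (Metric.mem_ball_self hε)
    exact (norm_le_pi_norm (T y s - T θ s) c).trans h3)
  simpa using h

/-- The vectors `G c` depend on the state only, so the auxiliary randomness can be integrated first,
replacing each weight by its conditional mean `m s c`. -/
lemma integrable_sum_weights_smul {S Y E : Type*} [MeasurableSpace S] [MeasurableSpace Y]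
    [NormedAddCommGroup E] [NormedSpace ℝ E] [CompleteSpace E] [MeasurableSpace E] [BorelSpace E]
    [SecondCountableTopology E] {C : ℕ}
    {ρ : Measure S} [SFinite ρ] {μ : Measure Y} [SFinite μ] {g : S × Y → Fin C → ℝ}
    (hg : ∀ c, Measurable fun x => g x c) {b : S → ℝ≥0∞} {m : S → Fin C → ℝ}
    (hb : ∀ s c, ∫⁻ y, ‖g (s, y) c‖ₑ ∂μ ≤ b s)
    (hi : ∀ s c, Integrable (fun y => g (s, y) c) μ)
    (hm : ∀ s c, ∫ y, g (s, y) c ∂μ = m s c)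
    {G : Fin C → S → E} (hG : ∀ c, Measurable (G c)) {L : S → ℝ≥0∞}
    (hGL : ∀ᵐ s ∂ρ, ∀ c, ‖G c s‖ₑ ≤ L s) (hfin : ∫⁻ s, L s * b s ∂ρ ≠ ∞) :
    Integrable (fun x => ∑ c, g x c • G c x.1) (ρ.prod μ) ∧
      ∫ x, ∑ c, g x c • G c x.1 ∂(ρ.prod μ) = ∫ s, ∑ c, m s c • G c s ∂ρ := by
  have hmeas : ∀ c, Measurable fun x : S × Y => g x c • G c x.1 := fun c =>
    (hg c).smul ((hG c).comp measurable_fst)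
  have hint : Integrable (fun x => ∑ c, g x c • G c x.1) (ρ.prod μ) := by
    refine integrable_finsetSum _ fun c _ => ⟨(hmeas c).aestronglyMeasurable, ?_⟩
    refine lt_of_le_of_lt ?_ hfin.lt_top
    rw [lintegral_prod _ (hmeas c).enorm.aemeasurable]
    refine lintegral_mono_ae ?_
    filter_upwards [hGL] with s hs
    simp only [enorm_smul]
    have hgc : Measurable fun y => ‖g (s, y) c‖ₑ :=
      ((hg c).comp measurable_prodMk_left).enorm
    rw [lintegral_mul_const _ hgc, mul_comm]
    exact mul_le_mul' (hs c) (hb s c)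
  refine ⟨hint, ?_⟩
  rw [integral_prod _ hint]
  refine integral_congr_ae (Filter.Eventually.of_forall fun s => ?_)
  simp only
  rw [integral_finsetSum _ fun c _ => (hi s c).smul_const _]
  exact Finset.sum_congr rfl fun c _ => by rw [integral_smul_const, hm]

section Estimators

variable {S : Type*} [MeasurableSpace S] {C : ℕ} [NeZero C]

lemma measurable_gARS_prod {q φ : S → Fin C → ℝ} (hq : ∀ a, Measurable fun s => q s a)
    (hφ : Measurable φ) (c : Fin C) :
    Measurable fun x : S × Fin C × (Fin C → ℝ) => gARS (q x.1) (φ x.1) x.2.2 x.2.1 c := by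
  have hqz : Measurable fun z : S × Fin C => q z.1 z.2 :=
    measurable_from_prod_countable_left hq
  have h : ∀ m : Fin C, Measurable fun x : S × Fin C × (Fin C → ℝ) =>
      q x.1 (pseudoAction (φ x.1) x.2.2 m x.2.1) := by
    intro m
    have hp : Measurable fun x : S × Fin C × (Fin C → ℝ) =>
        pseudoAction (φ x.1) x.2.2 m x.2.1 :=
      (hφ.comp measurable_fst).pseudoAction measurable_snd.snd measurable_snd.fst m
    exact hqz.comp (measurable_fst.prodMk hp)
  have hw : Measurable fun x : S × Fin C × (Fin C → ℝ) => x.2.2 x.2.1 := by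
    have : Measurable fun p : Fin C × (Fin C → ℝ) => p.2 p.1 :=
      measurable_from_prod_countable_right fun j => measurable_pi_apply j
    exact this.comp measurable_snd
  unfold gARS fDelta
  exact ((h c).sub (measurable_const.mul (Finset.measurable_sum _ fun m _ => h m))).mul
    (measurable_const.sub (measurable_const.mul hw))

variable {E : Type*} [NormedAddCommGroup E] [NormedSpace ℝ E] [CompleteSpace E]
  [MeasurableSpace E] [BorelSpace E] [SecondCountableTopology E]
  {ρ : Measure S} [SFinite ρ] {q φ : S → Fin C → ℝ} {G : Fin C → S → E} {L : S → ℝ≥0∞}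

lemma lintegral_mul_const_mul_ne_top {S : Type*} [MeasurableSpace S] {ρ : Measure S}
    {K : ℝ≥0∞} (hK : K ≠ ∞) {f g : S → ℝ≥0∞}
    (h : ∫⁻ s, f s * g s ∂ρ ≠ ∞) : ∫⁻ s, f s * (K * g s) ∂ρ ≠ ∞ := by
  simp only [mul_left_comm _ K]
  rw [lintegral_const_mul' _ _ hK]
  exact ENNReal.mul_ne_top hK h

lemma integrable_gARS_smul (hq : ∀ a, Measurable fun s => q s a) (hφ : Measurable φ)
    (hG : ∀ c, Measurable (G c)) (hGL : ∀ᵐ s ∂ρ, ∀ c, ‖G c s‖ₑ ≤ L s)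
    (hfin : ∫⁻ s, L s * ∑ a, ENNReal.ofReal (softmax (φ s) a) * ‖q s a‖ₑ ∂ρ ≠ ∞)
    (ν : Measure (Fin C)) [IsProbabilityMeasure ν] :
    Integrable (fun x : S × Fin C × (Fin C → ℝ) =>
        ∑ c, gARS (q x.1) (φ x.1) x.2.2 x.2.1 c • G c x.1)
      (ρ.prod (ν.prod (dirichlet C fun _ => 1))) ∧
    ∫ x, ∑ c, gARS (q x.1) (φ x.1) x.2.2 x.2.1 c • G c x.1
        ∂(ρ.prod (ν.prod (dirichlet C fun _ => 1))) =
      ∫ s, ∑ c, (softmax (φ s) c * q s c -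
        softmax (φ s) c * ∑ a, softmax (φ s) a * q s a) • G c s ∂ρ := by
  have hmeas : ∀ s c, Measurable fun y : Fin C × (Fin C → ℝ) =>
      gARS (q s) (φ s) y.2 y.1 c := fun s c =>
    (measurable_gARS_prod hq hφ c).comp measurable_prodMk_left
  have hb : ∀ s c, ∫⁻ y : Fin C × (Fin C → ℝ), ‖gARS (q s) (φ s) y.2 y.1 c‖ₑ
      ∂(ν.prod (dirichlet C fun _ => 1)) ≤
      (1 + C) * C * ∑ a, ENNReal.ofReal (softmax (φ s) a) * ‖q s a‖ₑ := by
    intro s c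
    rw [lintegral_prod _ (hmeas s c).enorm.aemeasurable]
    refine (lintegral_mono fun j => lintegral_enorm_gARS_le (q s) (φ s) j c).trans ?_
    simp
  have hKtop : ((1 + C) * C : ℝ≥0∞) ≠ ∞ := by finiteness
  have hi : ∀ s c, Integrable (fun y : Fin C × (Fin C → ℝ) => gARS (q s) (φ s) y.2 y.1 c)
      (ν.prod (dirichlet C fun _ => 1)) := by
    intro s c
    refine ⟨(hmeas s c).aestronglyMeasurable, (hb s c).trans_lt ?_⟩
    refine ENNReal.mul_lt_top hKtop.lt_top (ENNReal.sum_lt_top.mpr fun a _ => ?_)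
    exact ENNReal.mul_lt_top ENNReal.ofReal_lt_top enorm_lt_top
  have hm : ∀ s c, ∫ y : Fin C × (Fin C → ℝ), gARS (q s) (φ s) y.2 y.1 c
      ∂(ν.prod (dirichlet C fun _ => 1)) =
      softmax (φ s) c * q s c - softmax (φ s) c * ∑ a, softmax (φ s) a * q s a := by
    intro s c
    rw [integral_prod _ (hi s c)]
    simp only [integral_gARS]
    simp
  have hfin' : ∫⁻ s, L s * ((1 + C) * C *
      ∑ a, ENNReal.ofReal (softmax (φ s) a) * ‖q s a‖ₑ) ∂ρ ≠ ∞ :=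
    lintegral_mul_const_mul_ne_top hKtop hfin
  exact integrable_sum_weights_smul (ρ := ρ) (μ := ν.prod (dirichlet C fun _ => 1))
    (g := fun x c => gARS (q x.1) (φ x.1) x.2.2 x.2.1 c)
    (b := fun s => (1 + C) * C * ∑ a, ENNReal.ofReal (softmax (φ s) a) * ‖q s a‖ₑ)
    (m := fun s c => softmax (φ s) c * q s c - softmax (φ s) c * ∑ a, softmax (φ s) a * q s a)
    (fun c => measurable_gARS_prod hq hφ c) hb hi hm hG hGL
    hfin'

lemma integrable_gARSM_smul (hq : ∀ a, Measurable fun s => q s a) (hφ : Measurable φ)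
    (hG : ∀ c, Measurable (G c)) (hGL : ∀ᵐ s ∂ρ, ∀ c, ‖G c s‖ₑ ≤ L s)
    (hfin : ∫⁻ s, L s * ∑ a, ENNReal.ofReal (softmax (φ s) a) * ‖q s a‖ₑ ∂ρ ≠ ∞) :
    Integrable (fun x : S × (Fin C → ℝ) => ∑ c, gARSM (q x.1) (φ x.1) x.2 c • G c x.1)
      (ρ.prod (dirichlet C fun _ => 1)) ∧
    ∫ x, ∑ c, gARSM (q x.1) (φ x.1) x.2 c • G c x.1 ∂(ρ.prod (dirichlet C fun _ => 1)) =
      ∫ s, ∑ c, (softmax (φ s) c * q s c -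
        softmax (φ s) c * ∑ a, softmax (φ s) a * q s a) • G c s ∂ρ := by
  have hC : (1 : ℝ) ≤ C := Nat.one_le_cast.mpr (NeZero.one_le)
  have hKtop : (C * ((1 + C) * C) : ℝ≥0∞) ≠ ∞ := by finiteness
  have hi : ∀ s c, Integrable (fun w : Fin C → ℝ => gARSM (q s) (φ s) w c)
      (dirichlet C fun _ => 1) := by
    intro s c
    simp only [gARSM_eq]
    exact integrable_finsetSum _ fun j _ => (integrable_gARS _ _ j c).const_mul _
  refine integrable_sum_weights_smul (g := fun x c => gARSM (q x.1) (φ x.1) x.2 c)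
    (b := fun s => C * ((1 + C) * C) * ∑ a, ENNReal.ofReal (softmax (φ s) a) * ‖q s a‖ₑ)
    (fun c => ?_) (fun s c => ?_) hi (fun s c => ?_) hG hGL
    (lintegral_mul_const_mul_ne_top (f := L)
      (g := fun s => ∑ a, ENNReal.ofReal (softmax (φ s) a) * ‖q s a‖ₑ) hKtop hfin)
  · simp only [gARSM_eq]
    refine Finset.measurable_sum _ fun j _ => measurable_const.mul ?_
    exact (measurable_gARS_prod hq hφ c).comp
      (by fun_prop : Measurable fun x : S × (Fin C → ℝ) => (x.1, j, x.2))
  · have hle : ∀ w, ‖gARSM (q s) (φ s) w c‖ₑ ≤ ∑ j, ‖gARS (q s) (φ s) w j c‖ₑ := by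
      intro w
      rw [gARSM_eq]
      refine (enorm_sum_le _ _).trans (Finset.sum_le_sum fun j _ => ?_)
      rw [enorm_mul]
      refine mul_le_of_le_one_left' ?_
      rw [← ofReal_norm, Real.norm_of_nonneg (by positivity)]
      exact ENNReal.ofReal_le_one.mpr ((div_le_one (by positivity)).mpr hC)
    refine (lintegral_mono hle).trans ?_
    rw [lintegral_finsetSum _ fun j _ => (measurable_gARS (q s) (φ s) j c).enorm]
    refine (Finset.sum_le_sum fun j _ => lintegral_enorm_gARS_le (q s) (φ s) j c).trans ?_
    simp [mul_assoc]
  · simp only [gARSM_eq]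
    rw [integral_finsetSum _ fun j _ => (integrable_gARS _ _ j c).const_mul _]
    simp only [integral_const_mul, integral_gARS, Finset.sum_const, Finset.card_univ,
      Fintype.card_fin, nsmul_eq_mul]
    field_simp

end Estimators

/-! ### Double series and integration against counting measure -/

lemma ENNReal.tsum_sum_antidiagonal (f : ℕ → ℕ → ℝ≥0∞) :
    ∑' t, ∑ p ∈ Finset.HasAntidiagonal.antidiagonal t, f p.1 p.2 = ∑' i, ∑' k, f i k := by
  rw [← ENNReal.tsum_prod, ← Finset.HasAntidiagonal.sigmaAntidiagonalEquivProd.tsum_eq,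
    ENNReal.tsum_sigma']
  refine tsum_congr fun t => ?_
  rw [← Finset.tsum_subtype]
  rfl

lemma Summable.tsum_sum_antidiagonal {E : Type*} [NormedAddCommGroup E] [CompleteSpace E]
    {f : ℕ × ℕ → E} (hf : Summable f) :
    ∑' t, ∑ p ∈ Finset.HasAntidiagonal.antidiagonal t, f p = ∑' i, ∑' k, f (i, k) := by
  rw [← hf.tsum_prod, ← Finset.HasAntidiagonal.sigmaAntidiagonalEquivProd.tsum_eq, Summable.tsum_sigma]
  · refine tsum_congr fun t => ?_
    rw [← Finset.tsum_subtype]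
    rfl
  · exact (Finset.HasAntidiagonal.sigmaAntidiagonalEquivProd.summable_iff (f := f)).mpr hf

lemma Finset.sum_range_succ_eq_sum_antidiagonal {E : Type*} [AddCommMonoid E] (t : ℕ)
    (f : ℕ → ℕ → E) :
    ∑ i ∈ Finset.range (t + 1), f i t =
      ∑ p ∈ Finset.HasAntidiagonal.antidiagonal t, f p.1 (p.1 + p.2) := by
  rw [Finset.Nat.sum_antidiagonal_eq_sum_range_succ_mk]
  refine Finset.sum_congr rfl fun i hi => ?_
  simp only
  rw [Nat.add_sub_cancel' (Nat.lt_succ_iff.mp (Finset.mem_range.mp hi))]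

/-- The series over time becomes one integral, so the whole return is differentiated at once. -/
lemma integral_count_prod {Ω E : Type*} [MeasurableSpace Ω] {P : Measure Ω} [SFinite P]
    [NormedAddCommGroup E] [NormedSpace ℝ E] [CompleteSpace E] {f : ℕ × Ω → E}
    (hf : Integrable f ((Measure.count : Measure ℕ).prod P)) :
    ∫ x, f x ∂((Measure.count : Measure ℕ).prod P) = ∑' t, ∫ ω, f (t, ω) ∂P := by
  rw [integral_prod _ hf, integral_countable hf.integral_prod_left]
  simp

lemma lintegral_count_prod {Ω : Type*} [MeasurableSpace Ω] {P : Measure Ω} [SFinite P]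
    {f : ℕ × Ω → ℝ≥0∞} (hf : Measurable f) :
    ∫⁻ x, f x ∂((Measure.count : Measure ℕ).prod P) = ∑' t, ∫⁻ ω, f (t, ω) ∂P := by
  rw [lintegral_prod _ hf.aemeasurable, lintegral_count]

lemma ae_count_prod {Ω : Type*} [MeasurableSpace Ω] {P : Measure Ω} [SFinite P]
    {p : ℕ × Ω → Prop} (h : ∀ t, ∀ᵐ ω ∂P, p (t, ω)) :
    ∀ᵐ x ∂((Measure.count : Measure ℕ).prod P), p x := by
  -- The exceptional sets need not be measurable, so they are enlarged to measurable null sets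
  -- before being assembled in the product.
  choose s hs hms hs0 using fun t => exists_measurable_superset_of_null (ae_iff.mp (h t))
  have hm : MeasurableSet {x : ℕ × Ω | x.2 ∈ s x.1} := by
    have : {x : ℕ × Ω | x.2 ∈ s x.1} = ⋃ t, ({t} : Set ℕ) ×ˢ s t := by
      ext ⟨t, ω⟩; simp
    rw [this]
    exact MeasurableSet.iUnion fun t => (measurableSet_singleton t).prod (hms t)
  rw [ae_iff]
  refine measure_mono_null (t := {x : ℕ × Ω | x.2 ∈ s x.1}) (fun x hx => hs x.1 hx) ?_
  rw [Measure.prod_apply hm]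
  simp only [Set.preimage_ofPred_eq, Set.ofPred_mem_eq, lintegral_count]
  exact ENNReal.tsum_eq_zero.mpr hs0

/-! ### Visitation measure and action values along trajectories -/

namespace MDP

variable {S : Type*} [MeasurableSpace S] {C : ℕ} (M : MDP S C)

/-- Every weight `γ ^ t` is positive, so a null set of the visitation measure is null for the law of
each `s_t`. -/
lemma ae_traj_of_ae_visitation {π : Kernel S (Fin C)} [IsMarkovKernel π] {p : S → Prop}
    (h : ∀ᵐ s ∂(M.visitation π), p s) (t : ℕ) : ∀ᵐ ω ∂(M.traj π), p (ω t).1 := by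
  have h1 := (Measure.ae_sum_iff.mp h) t
  rw [ae_iff, Measure.smul_apply, smul_eq_mul] at h1
  have h2 := (mul_eq_zero.mp h1).resolve_left (ENNReal.ofReal_pos.mpr (pow_pos M.γ_pos t)).ne'
  exact ae_of_ae_map (measurable_pi_apply t).fst.aemeasurable h2

lemma measurable_discountedReturn : Measurable M.discountedReturn := by
  have hr := M.measurable_reward
  unfold discountedReturn
  exact Measurable.tsum fun t => by fun_prop

instance (π : Kernel S (Fin C)) [IsMarkovKernel π] : SFinite (M.visitation π) := by
  unfold visitation
  infer_instance

lemma lintegral_visitation (π : Kernel S (Fin C)) [IsMarkovKernel π] {f : S → ℝ≥0∞}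
    (hf : Measurable f) :
    ∫⁻ s, f s ∂(M.visitation π) =
      ∑' t, ENNReal.ofReal (M.γ ^ t) * ∫⁻ ω, f (ω t).1 ∂(M.traj π) := by
  unfold visitation
  rw [lintegral_sum_measure]
  refine tsum_congr fun t => ?_
  rw [lintegral_smul_measure, lintegral_map hf (measurable_pi_apply t).fst, smul_eq_mul]

/-- The discounted absolute reward at time `t`. -/
noncomputable def absReward (t : ℕ) (z : S × Fin C) : ℝ≥0∞ :=
  ENNReal.ofReal (M.γ ^ t * |M.reward z|)

lemma measurable_absReward (t : ℕ) : Measurable (M.absReward t) := by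
  have := M.measurable_reward
  unfold absReward
  fun_prop

lemma absReward_eq_enorm (t : ℕ) (z : S × Fin C) :
    M.absReward t z = ‖M.γ ^ t * M.reward z‖ₑ := by
  rw [absReward, ← ofReal_norm, norm_mul, Real.norm_eq_abs, Real.norm_eq_abs,
    abs_of_pos (pow_pos M.γ_pos t)]

lemma absReward_add (i k : ℕ) (z : S × Fin C) :
    M.absReward (i + k) z = ENNReal.ofReal (M.γ ^ i) * M.absReward k z := by
  rw [absReward, absReward, ← ENNReal.ofReal_mul (pow_pos M.γ_pos i).le, pow_add, mul_assoc]

lemma enorm_discountedReturn_le (ω : ℕ → S × Fin C) :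
    ‖M.discountedReturn ω‖ₑ ≤ ∑' t, M.absReward t (ω t) := by
  simp only [absReward_eq_enorm]
  exact enorm_tsum_le_tsum_enorm

lemma Q_eq (π : Kernel S (Fin C)) [IsMarkovKernel π] (s : S) (a : Fin C) :
    M.Q π s a = ∫ ω, M.discountedReturn ω ∂(M.trajKernel π (s, a)) := by
  rw [Q, trajFrom_dirac]

lemma measurable_Q (π : Kernel S (Fin C)) [IsMarkovKernel π] :
    Measurable fun z : S × Fin C => M.Q π z.1 z.2 := by
  simp only [Q_eq]
  exact (StronglyMeasurable.integral_kernel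
    M.measurable_discountedReturn.stronglyMeasurable).measurable

variable {π : Kernel S (Fin C)} [IsMarkovKernel π]

/-- By the Markov property at time `i`, the trajectory from time `i` on has law `trajKernel (ω i)`
given `ω i`; the modulus of `Q` is at most the mean of the absolute return of that trajectory. -/
lemma lintegral_enorm_Q_mul_le (i : ℕ) {g : S × Fin C → ℝ≥0∞} (hg : Measurable g) :
    ∫⁻ ω, ‖M.Q π (ω i).1 (ω i).2‖ₑ * g (ω i) ∂(M.traj π) ≤
      ∑' k, ∫⁻ ω, M.absReward k (ω (i + k)) * g (ω i) ∂(M.traj π) := by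
  have hprob : IsProbabilityMeasure ((M.traj π).map (fun ω => ω i)) :=
    Measure.isProbabilityMeasure_map (measurable_pi_apply i).aemeasurable
  have hA : ∀ k, Measurable fun ω : ℕ → S × Fin C => M.absReward k (ω k) := fun k =>
    (M.measurable_absReward k).comp (measurable_pi_apply k)
  have hA' : Measurable fun p : (S × Fin C) × (ℕ → S × Fin C) =>
      (∑' k, M.absReward k (p.2 k)) * g p.1 :=
    ((Measurable.tsum hA).comp measurable_snd).mul (hg.comp measurable_fst)
  have hQ : Measurable fun z : S × Fin C => ‖M.Q π z.1 z.2‖ₑ * g z :=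
    (M.measurable_Q π).enorm.mul hg
  calc ∫⁻ ω, ‖M.Q π (ω i).1 (ω i).2‖ₑ * g (ω i) ∂(M.traj π)
      = ∫⁻ z, ‖M.Q π z.1 z.2‖ₑ * g z ∂((M.traj π).map (fun ω => ω i)) :=
        (lintegral_map hQ (measurable_pi_apply i)).symm
    _ ≤ ∫⁻ z, ∫⁻ ω, (∑' k, M.absReward k (ω k)) * g z ∂(M.trajKernel π z)
          ∂((M.traj π).map (fun ω => ω i)) := by
        refine lintegral_mono fun z => ?_
        simp only
        rw [lintegral_mul_const _ (Measurable.tsum hA)]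
        gcongr
        rw [Q_eq]
        exact (enorm_integral_le_lintegral_enorm _).trans
          (lintegral_mono fun ω => M.enorm_discountedReturn_le ω)
    _ = ∫⁻ ω, (∑' k, M.absReward k (ω (i + k))) * g (ω i) ∂(M.traj π) := by
        rw [← Measure.lintegral_compProd hA', traj, ← trajFrom_map_prod_add,
          lintegral_map hA' (by fun_prop)]
    _ = _ := by
        simp only [← ENNReal.tsum_mul_right]
        refine lintegral_tsum fun k => Measurable.aemeasurable ?_
        exact ((M.measurable_absReward k).comp (measurable_pi_apply _)).mul
          (hg.comp (measurable_pi_apply i))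

lemma integral_discountedReturn_shift_smul {E : Type*} [NormedAddCommGroup E] [NormedSpace ℝ E]
    [CompleteSpace E] [MeasurableSpace E] [BorelSpace E] [SecondCountableTopology E] (i : ℕ)
    {ψ : S × Fin C → E} (hψ : Measurable ψ)
    (hint : Integrable (fun ω => M.discountedReturn (fun k => ω (i + k)) • ψ (ω i)) (M.traj π)) :
    ∫ ω, M.discountedReturn (fun k => ω (i + k)) • ψ (ω i) ∂(M.traj π) =
      ∫ ω, M.Q π (ω i).1 (ω i).2 • ψ (ω i) ∂(M.traj π) := by
  have hprob : IsProbabilityMeasure ((M.traj π).map (fun ω => ω i)) :=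
    Measure.isProbabilityMeasure_map (measurable_pi_apply i).aemeasurable
  have hF : Measurable fun p : (S × Fin C) × (ℕ → S × Fin C) =>
      M.discountedReturn p.2 • ψ p.1 :=
    (M.measurable_discountedReturn.comp measurable_snd).smul (hψ.comp measurable_fst)
  have hsh : Measurable fun ω : ℕ → S × Fin C => (ω i, fun k => ω (i + k)) := by fun_prop
  have hQ : Measurable fun z : S × Fin C => M.Q π z.1 z.2 • ψ z := (M.measurable_Q π).smul hψ
  have hmap : (M.traj π).map (fun ω => (ω i, fun k => ω (i + k))) =
      (M.traj π).map (fun ω => ω i) ⊗ₘ M.trajKernel π := M.trajFrom_map_prod_add π _ i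
  have hint' : Integrable (fun p : (S × Fin C) × (ℕ → S × Fin C) =>
      M.discountedReturn p.2 • ψ p.1)
      ((M.traj π).map (fun ω => ω i) ⊗ₘ M.trajKernel π) := by
    rw [← hmap]
    exact (integrable_map_measure hF.aestronglyMeasurable hsh.aemeasurable).mpr hint
  calc ∫ ω, M.discountedReturn (fun k => ω (i + k)) • ψ (ω i) ∂(M.traj π)
      = ∫ p, M.discountedReturn p.2 • ψ p.1
          ∂((M.traj π).map (fun ω => (ω i, fun k => ω (i + k)))) :=
        (integral_map hsh.aemeasurable hF.aestronglyMeasurable).symm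
    _ = ∫ z, M.Q π z.1 z.2 • ψ z ∂((M.traj π).map (fun ω => ω i)) := by
        rw [hmap, Measure.integral_compProd hint']
        refine integral_congr_ae (Filter.Eventually.of_forall fun z => ?_)
        simp only
        rw [integral_smul_const, Q_eq]
    _ = _ := integral_map (measurable_pi_apply i).aemeasurable hQ.aestronglyMeasurable

end MDP

/-! ### Integrability of rewards and action values -/

namespace MDP

section Integrability

variable {S : Type*} [MeasurableSpace S] {C : ℕ} (M : MDP S C) {π : Kernel S (Fin C)}
  [IsMarkovKernel π]

lemma measurable_absReward_mul (t j : ℕ) {g : (ℕ → S × Fin C) → ℝ≥0∞} (hg : Measurable g) :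
    Measurable fun ω : ℕ → S × Fin C => M.absReward t (ω j) * g ω :=
  ((M.measurable_absReward t).comp (measurable_pi_apply j)).mul hg

/-- With `t = i + k`, summing over `i` and `k` is summing over `t` and `i ≤ t`. -/
lemma tsum_lintegral_absReward_add (g : S × Fin C → ℝ≥0∞) (hg : Measurable g) :
    ∑' i, ∑' k, ∫⁻ ω, M.absReward (i + k) (ω (i + k)) * g (ω i) ∂(M.traj π) =
      ∑' t, ∫⁻ ω, M.absReward t (ω t) * ∑ i ∈ Finset.range (t + 1), g (ω i) ∂(M.traj π) := by
  rw [← ENNReal.tsum_sum_antidiagonal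
    (fun i k => ∫⁻ ω, M.absReward (i + k) (ω (i + k)) * g (ω i) ∂(M.traj π))]
  refine tsum_congr fun t => ?_
  rw [← Finset.sum_range_succ_eq_sum_antidiagonal t
    (fun i t => ∫⁻ ω, M.absReward t (ω t) * g (ω i) ∂(M.traj π))]
  simp only [Finset.mul_sum]
  have hm : ∀ i ∈ Finset.range (t + 1), Measurable fun ω : ℕ → S × Fin C =>
      M.absReward t (ω t) * g (ω i) := fun i _ =>
    M.measurable_absReward_mul t t (hg.comp (measurable_pi_apply i))
  rw [lintegral_finsetSum _ hm]

lemma J_eq_tsum (h : ∑' t, ∫⁻ ω, M.absReward t (ω t) ∂(M.traj π) ≠ ∞) :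
    M.J π = ∑' t, ∫ ω, M.γ ^ t * M.reward (ω t) ∂(M.traj π) := by
  have hr := M.measurable_reward
  simp only [absReward_eq_enorm] at h
  exact integral_tsum (fun t => Measurable.aestronglyMeasurable (by fun_prop)) h

lemma ae_summable_reward (h : ∑' t, ∫⁻ ω, M.absReward t (ω t) ∂(M.traj π) ≠ ∞) :
    ∀ᵐ ω ∂(M.traj π), Summable fun t => M.γ ^ t * M.reward (ω t) := by
  have hm : ∀ t, Measurable fun ω : ℕ → S × Fin C => M.absReward t (ω t) := fun t =>
    (M.measurable_absReward t).comp (measurable_pi_apply t)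
  rw [← lintegral_tsum fun t => (hm t).aemeasurable] at h
  filter_upwards [ae_lt_top (Measurable.tsum hm) h] with ω hω
  simp only [absReward_eq_enorm] at hω
  exact Summable.of_enorm hω.ne

lemma summable_reward_shift {ω : ℕ → S × Fin C}
    (h : Summable fun t => M.γ ^ t * M.reward (ω t)) (i : ℕ) :
    Summable fun k => M.γ ^ k * M.reward (ω (i + k)) := by
  have h1 := (summable_nat_add_iff i).mpr h
  refine (summable_mul_left_iff (pow_pos M.γ_pos i).ne').mp (h1.congr fun k => ?_)
  rw [add_comm k i, pow_add, mul_assoc]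

end Integrability

section Softmax

variable {S : Type*} [MeasurableSpace S] {C : ℕ} [NeZero C] (M : MDP S C)
  {φ : S → Fin C → ℝ} (hφ : Measurable φ)

lemma lintegral_traj_softmaxPolicy {f : S × Fin C → ℝ≥0∞} (hf : Measurable f) (i : ℕ) :
    ∫⁻ ω, f (ω i) ∂(M.traj (softmaxPolicy φ hφ)) =
      ∫⁻ ω, ∑ a, ENNReal.ofReal (softmax (φ (ω i).1) a) * f ((ω i).1, a)
        ∂(M.traj (softmaxPolicy φ hφ)) := by
  have : IsProbabilityMeasure ((M.traj (softmaxPolicy φ hφ)).map (fun ω => (ω i).1)) :=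
    Measure.isProbabilityMeasure_map (measurable_pi_apply i).fst.aemeasurable
  have hm : Measurable fun s => ∑ a, ENNReal.ofReal (softmax (φ s) a) * f (s, a) :=
    Finset.measurable_sum _ fun a _ => (((measurable_softmax a).comp hφ).ennreal_ofReal).mul
      (hf.comp measurable_prodMk_right)
  rw [← lintegral_map (g := fun ω : ℕ → S × Fin C => ω i) hf (measurable_pi_apply i),
    traj_map_eval, Measure.lintegral_compProd hf,
    ← lintegral_map (f := fun s => ∑ a, ENNReal.ofReal (softmax (φ s) a) * f (s, a))
      (g := fun ω : ℕ → S × Fin C => (ω i).1) hm (measurable_pi_apply i).fst]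
  exact lintegral_congr fun s => lintegral_catSoftmax (φ s) fun a => f (s, a)

lemma integral_traj_softmaxPolicy {E : Type*} [NormedAddCommGroup E] [NormedSpace ℝ E]
    [CompleteSpace E] {f : S × Fin C → E} (hf : StronglyMeasurable f) (i : ℕ)
    (hint : Integrable (fun ω => f (ω i)) (M.traj (softmaxPolicy φ hφ))) :
    ∫ ω, f (ω i) ∂(M.traj (softmaxPolicy φ hφ)) =
      ∫ s, ∑ a, softmax (φ s) a • f (s, a)
        ∂((M.traj (softmaxPolicy φ hφ)).map (fun ω => (ω i).1)) := by
  have : IsProbabilityMeasure ((M.traj (softmaxPolicy φ hφ)).map (fun ω => (ω i).1)) :=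
    Measure.isProbabilityMeasure_map (measurable_pi_apply i).fst.aemeasurable
  have hint' : Integrable f ((M.traj (softmaxPolicy φ hφ)).map (fun ω => (ω i).1) ⊗ₘ
      softmaxPolicy φ hφ) := by
    rw [← traj_map_eval]
    exact (integrable_map_measure hf.aestronglyMeasurable
      (measurable_pi_apply i).aemeasurable).mpr hint
  rw [← integral_map (φ := fun ω : ℕ → S × Fin C => ω i) (measurable_pi_apply i).aemeasurable
    hf.aestronglyMeasurable, traj_map_eval, Measure.integral_compProd hint']
  exact integral_congr_ae (Filter.Eventually.of_forall fun s =>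
    integral_catSoftmax (φ s) fun a => f (s, a))

/-- Averaging over the action at time `i` turns the inner sum into `|Q(s_i, a_i)|`. The factor `γ ^
i` from the visitation measure and the discount inside `Q` merge into `γ ^ (i + k)`, and regrouping
by `t = i + k` gives the hypothesised series. -/
lemma lintegral_visitation_mul_Q_le {L : S → ℝ≥0∞} (hL : Measurable L) :
    ∫⁻ s, L s * ∑ a, ENNReal.ofReal (softmax (φ s) a) * ‖M.Q (softmaxPolicy φ hφ) s a‖ₑ
        ∂(M.visitation (softmaxPolicy φ hφ)) ≤
      ∑' t, ∫⁻ ω, M.absReward t (ω t) * ∑ i ∈ Finset.range (t + 1), L (ω i).1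
        ∂(M.traj (softmaxPolicy φ hφ)) := by
  have hQ : Measurable fun z : S × Fin C => ‖M.Q (softmaxPolicy φ hφ) z.1 z.2‖ₑ :=
    (M.measurable_Q _).enorm
  have hg : Measurable fun z : S × Fin C => L z.1 := hL.comp measurable_fst
  have hQa : ∀ a, Measurable fun s => ‖M.Q (softmaxPolicy φ hφ) s a‖ₑ := fun a =>
    hQ.comp (g := fun z : S × Fin C => ‖M.Q (softmaxPolicy φ hφ) z.1 z.2‖ₑ)
      (f := fun s => (s, a)) measurable_prodMk_right
  have hσ : ∀ a, Measurable fun s => ENNReal.ofReal (softmax (φ s) a) := fun a =>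
    ((measurable_softmax a).comp hφ).ennreal_ofReal
  have hm : Measurable fun s => L s * ∑ a, ENNReal.ofReal (softmax (φ s) a) *
      ‖M.Q (softmaxPolicy φ hφ) s a‖ₑ :=
    hL.mul (Finset.measurable_sum _ fun a _ => (hσ a).mul (hQa a))
  rw [lintegral_visitation _ _ hm, ← M.tsum_lintegral_absReward_add (fun z => L z.1) hg]
  refine ENNReal.tsum_le_tsum fun i => ?_
  have h1 : ∫⁻ ω, L (ω i).1 * ∑ a, ENNReal.ofReal (softmax (φ (ω i).1) a) *
        ‖M.Q (softmaxPolicy φ hφ) (ω i).1 a‖ₑ ∂(M.traj (softmaxPolicy φ hφ)) =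
      ∫⁻ ω, ‖M.Q (softmaxPolicy φ hφ) (ω i).1 (ω i).2‖ₑ * L (ω i).1
        ∂(M.traj (softmaxPolicy φ hφ)) := by
    rw [M.lintegral_traj_softmaxPolicy hφ
      (f := fun z => ‖M.Q (softmaxPolicy φ hφ) z.1 z.2‖ₑ * L z.1) (hQ.mul hg) i]
    refine lintegral_congr fun ω => ?_
    rw [Finset.mul_sum]
    refine Finset.sum_congr rfl fun a _ => ?_
    rw [mul_comm (L _), mul_assoc]
  rw [h1]
  refine (mul_le_mul_right (M.lintegral_enorm_Q_mul_le i hg) _).trans ?_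
  rw [← ENNReal.tsum_mul_left]
  refine ENNReal.tsum_le_tsum fun k => ?_
  rw [← lintegral_const_mul' _ _ ENNReal.ofReal_ne_top]
  refine lintegral_mono fun ω => ?_
  simp only
  rw [absReward_add, mul_assoc]

end Softmax

/-! ### From likelihood-ratio scores to the policy gradient -/

section PolicyGradient

variable {S : Type*} [MeasurableSpace S] {C : ℕ} [NeZero C] (M : MDP S C)
  {E : Type*} [NormedAddCommGroup E] [InnerProductSpace ℝ E] [CompleteSpace E]
  [MeasurableSpace E] [BorelSpace E] [SecondCountableTopology E]

lemma enorm_scoreVector_le {E : Type*} [NormedAddCommGroup E] [NormedSpace ℝ E]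
    {φ : Fin C → ℝ} {G : Fin C → E} {l : ℝ≥0} (hG : ∀ c, ‖G c‖ ≤ l) (a : Fin C) :
    ‖scoreVector φ G a‖ₑ ≤ 2 * l := by
  have h1 : ‖scoreVector φ G a‖ ≤ 2 * l := by
    refine (norm_sub_le _ _).trans ?_
    have h2 : ‖∑ c, softmax φ c • G c‖ ≤ ∑ c, softmax φ c * l := by
      refine norm_sum_le_of_le _ fun c _ => ?_
      rw [norm_smul, Real.norm_of_nonneg (softmax_nonneg _ _)]
      exact mul_le_mul_of_nonneg_left (hG c) (softmax_nonneg _ _)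
    rw [← Finset.sum_mul, sum_softmax, one_mul] at h2
    linarith [hG a]
  rw [← ofReal_norm]
  refine (ENNReal.ofReal_le_ofReal h1).trans ?_
  rw [ENNReal.ofReal_mul zero_le_two]
  simp

lemma measurable_scoreVector {S E : Type*} [MeasurableSpace S] {C : ℕ} [NormedAddCommGroup E]
    [NormedSpace ℝ E] [MeasurableSpace E] [BorelSpace E] [SecondCountableTopology E]
    {φ : S → Fin C → ℝ} (hφ : Measurable φ) {G : Fin C → S → E}
    (hG : ∀ c, Measurable (G c)) :
    Measurable fun z : S × Fin C => scoreVector (φ z.1) (fun c => G c z.1) z.2 :=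
  measurable_from_prod_countable_left fun a => (hG a).sub
    (Finset.measurable_sum _ fun c _ => ((measurable_softmax c).comp hφ).smul (hG c))

/-- Rearrangement of the likelihood-ratio gradient into the policy gradient. -/
lemma integral_reward_smul_score {φ : S → Fin C → ℝ} (hφ : Measurable φ) {G : Fin C → S → E}
    (hG : ∀ c, Measurable (G c)) {L : S → ℝ≥0} (hL : Measurable L)
    (hGL : ∀ᵐ s ∂(M.visitation (softmaxPolicy φ hφ)), ∀ c, ‖G c s‖ ≤ L s)
    (hr : ∑' t, ∫⁻ ω, M.absReward t (ω t) ∂(M.traj (softmaxPolicy φ hφ)) ≠ ∞)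
    (hrL : ∑' t, ∫⁻ ω, M.absReward t (ω t) * ∑ i ∈ Finset.range (t + 1), (L (ω i).1 : ℝ≥0∞)
      ∂(M.traj (softmaxPolicy φ hφ)) ≠ ∞)
    (hint : Integrable (fun x : ℕ × (ℕ → S × Fin C) => (M.γ ^ x.1 * M.reward (x.2 x.1)) •
        ∑ i ∈ Finset.range (x.1 + 1),
          scoreVector (φ (x.2 i).1) (fun c => G c (x.2 i).1) (x.2 i).2)
      ((Measure.count : Measure ℕ).prod (M.traj (softmaxPolicy φ hφ)))) :
    ∫ x : ℕ × (ℕ → S × Fin C), (M.γ ^ x.1 * M.reward (x.2 x.1)) •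
        ∑ i ∈ Finset.range (x.1 + 1),
          scoreVector (φ (x.2 i).1) (fun c => G c (x.2 i).1) (x.2 i).2
        ∂((Measure.count : Measure ℕ).prod (M.traj (softmaxPolicy φ hφ))) =
      ∫ s, ∑ c, (softmax (φ s) c * M.Q (softmaxPolicy φ hφ) s c - softmax (φ s) c *
        ∑ a, softmax (φ s) a * M.Q (softmaxPolicy φ hφ) s a) • G c s
        ∂(M.visitation (softmaxPolicy φ hφ)) := by
  set π := softmaxPolicy φ hφ with hπ
  set ψ : S × Fin C → E := fun z => scoreVector (φ z.1) (fun c => G c z.1) z.2 with hψ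
  have hψm : Measurable ψ := measurable_scoreVector hφ hG
  have hrm := M.measurable_reward
  have hL' : Measurable fun s => (L s : ℝ≥0∞) := hL.coe_nnreal_ennreal
  have hψL : ∀ᵐ s ∂(M.visitation π), ∀ a, ‖ψ (s, a)‖ₑ ≤ 2 * L s := by
    filter_upwards [hGL] with s hs a
    exact enorm_scoreVector_le hs a
  have hψω : ∀ᵐ ω ∂(M.traj π), ∀ i, ‖ψ (ω i)‖ₑ ≤ 2 * L (ω i).1 := by
    refine ae_all_iff.mpr fun i => ?_
    filter_upwards [M.ae_traj_of_ae_visitation hψL i] with ω hω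
    exact hω (ω i).2
  -- Absolute convergence of the reward-score double series; every interchange of sums and integrals
  -- below rests on it. The factor `2` is the bound on the score.
  have hfin : ∑' i, ∑' k, ∫⁻ ω, M.absReward (i + k) (ω (i + k)) * ‖ψ (ω i)‖ₑ ∂(M.traj π) ≠ ∞ := by
    rw [M.tsum_lintegral_absReward_add (fun z => ‖ψ z‖ₑ) hψm.enorm]
    refine ne_top_of_le_ne_top (ENNReal.mul_ne_top ENNReal.ofNat_ne_top hrL : 2 * _ ≠ ∞) ?_
    rw [← ENNReal.tsum_mul_left]
    refine ENNReal.tsum_le_tsum fun t => ?_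
    rw [← lintegral_const_mul' _ _ ENNReal.ofNat_ne_top]
    refine lintegral_mono_ae ?_
    filter_upwards [hψω] with ω hω
    rw [mul_left_comm]
    gcongr
    rw [Finset.mul_sum]
    exact Finset.sum_le_sum fun i _ => hω i
  have hterm : ∀ i k, Integrable
      (fun ω => (M.γ ^ (i + k) * M.reward (ω (i + k))) • ψ (ω i)) (M.traj π) := by
    intro i k
    refine ⟨Measurable.aestronglyMeasurable (by fun_prop), ?_⟩
    refine lt_of_eq_of_lt ?_ (ENNReal.ne_top_of_tsum_ne_top
      (ENNReal.ne_top_of_tsum_ne_top hfin i) k).lt_top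
    refine lintegral_congr fun ω => ?_
    rw [enorm_smul, absReward_eq_enorm]
  set a : ℕ × ℕ → E := fun p =>
    ∫ ω, (M.γ ^ (p.1 + p.2) * M.reward (ω (p.1 + p.2))) • ψ (ω p.1) ∂(M.traj π) with ha
  have hsum : Summable a := by
    refine Summable.of_enorm (ne_top_of_le_ne_top hfin ?_)
    rw [← ENNReal.tsum_prod (f := fun i k =>
      ∫⁻ ω, M.absReward (i + k) (ω (i + k)) * ‖ψ (ω i)‖ₑ ∂(M.traj π))]
    refine ENNReal.tsum_le_tsum fun p => (enorm_integral_le_lintegral_enorm _).trans ?_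
    simp only [enorm_smul, absReward_eq_enorm, le_refl]
  -- The positive factor `γ ^ i` is divided out of the finite double series.
  have hshift : ∀ i, ∑' k, ∫⁻ ω, M.absReward k (ω (i + k)) * ‖ψ (ω i)‖ₑ ∂(M.traj π) ≠ ∞ := by
    intro i
    have h1 := ENNReal.ne_top_of_tsum_ne_top hfin i
    simp only [absReward_add, mul_assoc] at h1
    simp only [lintegral_const_mul' _ _ ENNReal.ofReal_ne_top, ENNReal.tsum_mul_left] at h1
    exact (ENNReal.lt_top_of_mul_ne_top_right h1
      (ENNReal.ofReal_pos.mpr (pow_pos M.γ_pos i)).ne').ne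
  have hQint : ∀ i, Integrable (fun ω => M.Q π (ω i).1 (ω i).2 • ψ (ω i)) (M.traj π) := by
    intro i
    have hm : Measurable fun z : S × Fin C => M.Q π z.1 z.2 • ψ z := (M.measurable_Q π).smul hψm
    refine ⟨(hm.comp (measurable_pi_apply i)).aestronglyMeasurable, ?_⟩
    refine lt_of_le_of_lt ?_ (hshift i).lt_top
    refine le_trans (le_of_eq ?_) (M.lintegral_enorm_Q_mul_le i hψm.enorm)
    exact lintegral_congr fun ω => enorm_smul _ _
  have hDint : ∀ i, Integrable
      (fun ω => M.discountedReturn (fun k => ω (i + k)) • ψ (ω i)) (M.traj π) := by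
    intro i
    have hdm := M.measurable_discountedReturn
    refine ⟨Measurable.aestronglyMeasurable (by fun_prop), ?_⟩
    refine lt_of_le_of_lt ?_ (hshift i).lt_top
    have hm : ∀ k, Measurable fun ω : ℕ → S × Fin C =>
        M.absReward k (ω (i + k)) * ‖ψ (ω i)‖ₑ := fun k =>
      M.measurable_absReward_mul k (i + k) (hψm.enorm.comp (measurable_pi_apply i))
    rw [← lintegral_tsum fun k => (hm k).aemeasurable]
    refine lintegral_mono fun ω => ?_
    simp only [enorm_smul]
    rw [ENNReal.tsum_mul_right]
    gcongr
    exact M.enorm_discountedReturn_le _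
  -- For fixed `i`, the rewards from time `i` on sum to `γ ^ i` times the return of the shifted
  -- trajectory, whose conditional mean given `ω i` is `Q`.
  have hinner : ∀ i, ∑' k, a (i, k) =
      M.γ ^ i • ∫ ω, M.Q π (ω i).1 (ω i).2 • ψ (ω i) ∂(M.traj π) := by
    intro i
    rw [← M.integral_discountedReturn_shift_smul i hψm (hDint i), ← integral_smul]
    simp only [ha]
    rw [← integral_tsum (fun k => (hterm i k).1)]
    · refine integral_congr_ae ?_
      filter_upwards [M.ae_summable_reward hr] with ω hω
      have h1 := M.summable_reward_shift hω i
      simp only [discountedReturn]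
      rw [← h1.tsum_smul_const, ← (h1.smul_const _).tsum_const_smul]
      refine tsum_congr fun k => ?_
      rw [smul_smul, pow_add, mul_assoc]
    · have h2 := ENNReal.ne_top_of_tsum_ne_top hfin i
      simpa only [enorm_smul, absReward_eq_enorm] using h2
  have hH : ∀ s, ∑ c, (softmax (φ s) c * M.Q π s c - softmax (φ s) c *
      ∑ a, softmax (φ s) a * M.Q π s a) • G c s =
      ∑ a, softmax (φ s) a • M.Q π s a • ψ (s, a) := fun s =>
    (sum_softmax_smul_scoreVector (φ s) (M.Q π s) fun c => G c s).symm
  have hHm : Measurable fun s => ∑ a, softmax (φ s) a • M.Q π s a • ψ (s, a) :=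
    Finset.measurable_sum _ fun a _ => ((measurable_softmax a).comp hφ).smul
      (((M.measurable_Q π).comp measurable_prodMk_right).smul
        (hψm.comp measurable_prodMk_right))
  have hHint : Integrable (fun s => ∑ a, softmax (φ s) a • M.Q π s a • ψ (s, a))
      (M.visitation π) := by
    refine ⟨hHm.aestronglyMeasurable, ?_⟩
    refine lt_of_le_of_lt ?_ (ENNReal.mul_lt_top (ENNReal.ofNat_lt_top (n := 2))
      ((M.lintegral_visitation_mul_Q_le hφ hL').trans_lt hrL.lt_top))
    rw [← lintegral_const_mul' _ _ ENNReal.ofNat_ne_top]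
    refine lintegral_mono_ae ?_
    filter_upwards [hψL] with s hs
    refine (enorm_sum_le _ _).trans ?_
    rw [← mul_assoc, Finset.mul_sum]
    refine Finset.sum_le_sum fun a _ => ?_
    rw [enorm_smul, enorm_smul, ← ofReal_norm (softmax (φ s) a),
      Real.norm_of_nonneg (softmax_nonneg _ _), ← mul_assoc, mul_comm]
    gcongr
    exact hs a
  rw [integral_count_prod hint]
  have hsplit : ∀ t, ∫ ω, (M.γ ^ t * M.reward (ω t)) • ∑ i ∈ Finset.range (t + 1), ψ (ω i)
      ∂(M.traj π) = ∑ p ∈ Finset.HasAntidiagonal.antidiagonal t, a p := by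
    intro t
    have h1 : ∀ i ∈ Finset.range (t + 1),
        Integrable (fun ω => (M.γ ^ t * M.reward (ω t)) • ψ (ω i)) (M.traj π) := by
      intro i hi
      have h2 := hterm i (t - i)
      rwa [Nat.add_sub_cancel' (Nat.lt_succ_iff.mp (Finset.mem_range.mp hi))] at h2
    simp only [Finset.smul_sum]
    rw [integral_finsetSum _ h1, Finset.sum_range_succ_eq_sum_antidiagonal t
      (fun i t => ∫ ω, (M.γ ^ t * M.reward (ω t)) • ψ (ω i) ∂(M.traj π))]
  refine (tsum_congr hsplit).trans ?_
  rw [hsum.tsum_sum_antidiagonal]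
  simp only [hinner]
  refine Eq.trans ?_ (integral_congr_ae (Filter.Eventually.of_forall fun s => (hH s).symm))
  unfold visitation at hHint ⊢
  rw [integral_sum_measure hHint]
  refine tsum_congr fun i => ?_
  have h3 := M.integral_traj_softmaxPolicy hφ (f := fun z => M.Q π z.1 z.2 • ψ z)
    ((M.measurable_Q π).smul hψm).stronglyMeasurable i (hQint i)
  rw [integral_smul_measure, ENNReal.toReal_ofReal (pow_pos M.γ_pos i).le]
  exact congrArg _ h3

end PolicyGradient

end MDP

lemma HasGradientAt.fun_sum {ι E : Type*} [NormedAddCommGroup E] [InnerProductSpace ℝ E]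
    [CompleteSpace E] {u : Finset ι} {f : ι → E → ℝ} {f' : ι → E} {x : E}
    (h : ∀ i ∈ u, HasGradientAt (f i) (f' i) x) :
    HasGradientAt (fun y => ∑ i ∈ u, f i y) (∑ i ∈ u, f' i) x := by
  rw [hasGradientAt_iff_hasFDerivAt, map_sum]
  exact HasFDerivAt.fun_sum fun i hi => (h i hi).hasFDerivAt

lemma HasGradientAt.const_mul_real {E : Type*} [NormedAddCommGroup E] [InnerProductSpace ℝ E]
    [CompleteSpace E] {f : E → ℝ} {f' x : E} (h : HasGradientAt f f' x) (c : ℝ) :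
    HasGradientAt (fun y => c * f y) (c • f') x := by
  rw [hasGradientAt_iff_hasFDerivAt, LinearIsometryEquiv.map_smulₛₗ]
  exact h.hasFDerivAt.const_mul c

/-! ### Differentiability of the expected return -/

namespace MDP

section LogRatio

variable {S : Type*} {C : ℕ}

lemma log_trajRatio (φ' φ : S → Fin C → ℝ) (t : ℕ) (ω : ℕ → S × Fin C) :
    Real.log (trajRatio φ' φ t ω) = ∑ i ∈ Finset.range (t + 1),
      (Real.log (softmax (φ' (ω i).1) (ω i).2) - Real.log (softmax (φ (ω i).1) (ω i).2)) := by
  rw [trajRatio, Real.log_prod fun i _ => (policyRatio_pos _ _ _).ne']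
  exact Finset.sum_congr rfl fun i _ =>
    Real.log_div (softmax_pos _ _).ne' (softmax_pos _ _).ne'

/-- The transition kernel cancels in the ratio, so only the `t + 1` log-policy differences remain,
each 2-Lipschitz in the logits. -/
lemma abs_log_trajRatio_le [NeZero C] {φ' φ : S → Fin C → ℝ} {L : S → ℝ≥0} {δ : ℝ}
    (h : ∀ s, ‖φ' s - φ s‖ ≤ L s * δ) (t : ℕ) (ω : ℕ → S × Fin C) :
    |Real.log (trajRatio φ' φ t ω)| ≤
      2 * (∑ i ∈ Finset.range (t + 1), (L (ω i).1 : ℝ)) * δ := by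
  rw [log_trajRatio, Finset.mul_sum, Finset.sum_mul]
  refine (Finset.abs_sum_le_sum_abs _ _).trans (Finset.sum_le_sum fun i _ => ?_)
  refine (abs_log_softmax_sub_le _ _ _).trans ?_
  rw [mul_assoc]
  exact mul_le_mul_of_nonneg_left (h _) zero_le_two

end LogRatio

variable {S : Type*} [MeasurableSpace S] {C : ℕ} [NeZero C] (M : MDP S C)

lemma lintegral_absReward_mul_changeOfMeasure {φ' φ : S → Fin C → ℝ} (hφ' : Measurable φ')
    (hφ : Measurable φ) {L : S → ℝ≥0∞} (hL : Measurable L) (t : ℕ) :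
    ∫⁻ ω, M.absReward t (ω t) * (1 + ∑ i ∈ Finset.range (t + 1), L (ω i).1)
        ∂(M.traj (softmaxPolicy φ' hφ')) =
      ∫⁻ ω, M.absReward t (ω t) * (1 + ∑ i ∈ Finset.range (t + 1), L (ω i).1) *
        ENNReal.ofReal (trajRatio φ' φ t ω) ∂(M.traj (softmaxPolicy φ hφ)) := by
  have hr := M.measurable_absReward t
  have h := M.lintegral_traj_changeOfMeasure hφ' hφ t
    (f := fun h => M.absReward t (h ⟨t, Finset.mem_Iic.mpr le_rfl⟩) *
      (1 + ∑ i : Fin (t + 1), L (h ⟨i, Finset.mem_Iic.mpr (Fin.is_le i)⟩).1)) (by fun_prop)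
  simp only [Finset.sum_range]
  exact h

section Gradient

variable {E : Type*} [NormedAddCommGroup E] [InnerProductSpace ℝ E] [CompleteSpace E]
  [MeasurableSpace E] [BorelSpace E] [SecondCountableTopology E]

/-- The policy gradient theorem for softmax policies. -/
theorem hasGradientAt_J {T : E → S → Fin C → ℝ} (hT : ∀ θ, Measurable (T θ)) {θ : E}
    {ε : ℝ} (hε : 0 < ε) {L : S → ℝ≥0} (hL : Measurable L)
    (hLip : ∀ s, LipschitzOnWith (L s) (fun θ' => T θ' s) (Metric.ball θ ε))
    {B : ℝ≥0} (hB : ∀ y ∈ Metric.ball θ ε,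
      ∑' t : ℕ, ∫⁻ ω, M.absReward t (ω t) *
        (1 + ∑ i ∈ Finset.range (t + 1), (L (ω i).1 : ℝ≥0∞))
          ∂(M.traj (softmaxPolicy (T y) (hT y))) ≤ B)
    {G : Fin C → S → E} (hG : ∀ c, Measurable (G c))
    (hgrad : ∀ᵐ s ∂(M.visitation (softmaxPolicy (T θ) (hT θ))), ∀ c,
      HasGradientAt (fun y => T y s c) (G c s) θ ∧ ‖G c s‖ ≤ L s) :
    HasGradientAt (fun y => M.J (softmaxPolicy (T y) (hT y)))
      (∫ s, ∑ c, (softmax (T θ s) c * M.Q (softmaxPolicy (T θ) (hT θ)) s c -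
        softmax (T θ s) c * ∑ a, softmax (T θ s) a *
          M.Q (softmaxPolicy (T θ) (hT θ)) s a) • G c s
        ∂(M.visitation (softmaxPolicy (T θ) (hT θ)))) θ := by
  have hθ : θ ∈ Metric.ball θ ε := Metric.mem_ball_self hε
  have hrm := M.measurable_reward
  have hL' : Measurable fun s => (L s : ℝ≥0∞) := hL.coe_nnreal_ennreal
  have hr : ∀ y ∈ Metric.ball θ ε,
      ∑' t, ∫⁻ ω, M.absReward t (ω t) ∂(M.traj (softmaxPolicy (T y) (hT y))) ≠ ∞ := by
    intro y hy
    refine ne_top_of_le_ne_top ENNReal.coe_ne_top (le_trans ?_ (hB y hy))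
    exact ENNReal.tsum_le_tsum fun t => lintegral_mono fun ω =>
      le_mul_of_one_le_right' le_self_add
  have hrL : ∑' t, ∫⁻ ω, M.absReward t (ω t) *
      ∑ i ∈ Finset.range (t + 1), (L (ω i).1 : ℝ≥0∞)
        ∂(M.traj (softmaxPolicy (T θ) (hT θ))) ≠ ∞ := by
    refine ne_top_of_le_ne_top ENNReal.coe_ne_top (le_trans ?_ (hB θ hθ))
    exact ENNReal.tsum_le_tsum fun t => lintegral_mono fun ω =>
      mul_le_mul_right le_add_self _
  set P := M.traj (softmaxPolicy (T θ) (hT θ)) with hP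
  set μ : Measure (ℕ × (ℕ → S × Fin C)) := (Measure.count : Measure ℕ).prod P with hμ
  set f : ℕ × (ℕ → S × Fin C) → ℝ := fun x => M.γ ^ x.1 * M.reward (x.2 x.1) with hf
  -- The factor `2` is the Lipschitz constant of the log-softmax.
  set K : ℕ × (ℕ → S × Fin C) → ℝ :=
    fun x => 2 * ∑ i ∈ Finset.range (x.1 + 1), (L (x.2 i).1 : ℝ) with hK
  set l : E → ℕ × (ℕ → S × Fin C) → ℝ :=
    fun y x => Real.log (trajRatio (T y) (T θ) x.1 x.2) with hl
  set D : ℕ × (ℕ → S × Fin C) → E := fun x => ∑ i ∈ Finset.range (x.1 + 1),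
    scoreVector (T θ (x.2 i).1) (fun c => G c (x.2 i).1) (x.2 i).2 with hD
  have hfm : Measurable f := measurable_from_prod_countable_right fun t => by
    simp only [hf]; fun_prop
  have hKm : Measurable K := measurable_from_prod_countable_right fun t => by
    simp only [hK]; fun_prop
  have hK0 : ∀ x, 0 ≤ K x := fun x => by simp only [hK]; positivity
  have hlm : ∀ y, Measurable (l y) := fun y => measurable_from_prod_countable_right fun t =>
    Real.measurable_log.comp (measurable_trajRatio (hT y) (hT θ) t)
  have hDm : Measurable D := measurable_from_prod_countable_right fun t =>
    Finset.measurable_sum (Finset.range (t + 1)) fun i _ =>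
      (measurable_scoreVector (hT θ) hG).comp (measurable_pi_apply i)
  have hexp : ∀ y x, Real.exp (l y x) = trajRatio (T y) (T θ) x.1 x.2 := fun y x =>
    Real.exp_log (trajRatio_pos _ _ _ _)
  have hlK : ∀ y ∈ Metric.ball θ ε, ∀ x, |l y x| ≤ K x * ‖y - θ‖ := fun y hy x =>
    abs_log_trajRatio_le (fun s => (hLip s).norm_sub_le hy hθ) x.1 x.2
  have hptw : ∀ y x, ENNReal.ofReal (|f x| * (1 + K x) * Real.exp (l y x)) ≤
      2 * (M.absReward x.1 (x.2 x.1) *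
        (1 + ∑ i ∈ Finset.range (x.1 + 1), (L (x.2 i).1 : ℝ≥0∞)) *
          ENNReal.ofReal (trajRatio (T y) (T θ) x.1 x.2)) := by
    intro y x
    have h0 : (0 : ℝ) ≤ ∑ i ∈ Finset.range (x.1 + 1), (L (x.2 i).1 : ℝ) := by positivity
    have h1 : ENNReal.ofReal |f x| = M.absReward x.1 (x.2 x.1) := by
      simp only [hf, absReward, abs_mul, abs_of_pos (pow_pos M.γ_pos _)]
    have h2 : ENNReal.ofReal (1 + K x) ≤
        2 * (1 + ∑ i ∈ Finset.range (x.1 + 1), (L (x.2 i).1 : ℝ≥0∞)) := by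
      have h3 : 2 * (1 + ∑ i ∈ Finset.range (x.1 + 1), (L (x.2 i).1 : ℝ≥0∞)) =
          ENNReal.ofReal (2 * (1 + ∑ i ∈ Finset.range (x.1 + 1), (L (x.2 i).1 : ℝ))) := by
        rw [ENNReal.ofReal_mul zero_le_two, ENNReal.ofReal_add zero_le_one h0,
          ENNReal.ofReal_sum_of_nonneg fun i _ => NNReal.coe_nonneg _]
        simp
      rw [h3]
      refine ENNReal.ofReal_le_ofReal ?_
      simp only [hK]
      linarith
    have hx := hK0 x
    rw [ENNReal.ofReal_mul (by positivity), ENNReal.ofReal_mul (abs_nonneg _), h1, hexp,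
      ← mul_assoc, mul_left_comm]
    gcongr
  -- Since `exp (l y)` is the likelihood ratio, changing the measure back to the policy at `y`
  -- recovers the hypothesised expectation. The bound `2 * B` absorbs the factor in `K`.
  have hBμ : ∀ y ∈ Metric.ball θ ε,
      ∫⁻ x, ENNReal.ofReal (|f x| * (1 + K x) * Real.exp (l y x)) ∂μ ≤ (2 * B : ℝ≥0) := by
    intro y hy
    refine (lintegral_mono (hptw y)).trans ?_
    rw [lintegral_const_mul' _ _ ENNReal.ofNat_ne_top, ENNReal.coe_mul]
    refine mul_le_mul_right (le_trans (le_of_eq ?_) (hB y hy)) _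
    have hm : Measurable fun x : ℕ × (ℕ → S × Fin C) => M.absReward x.1 (x.2 x.1) *
        (1 + ∑ i ∈ Finset.range (x.1 + 1), (L (x.2 i).1 : ℝ≥0∞)) *
          ENNReal.ofReal (trajRatio (T y) (T θ) x.1 x.2) := by
      refine measurable_from_prod_countable_right fun t => ?_
      have h1 := M.measurable_absReward t
      have h2 := measurable_trajRatio (hT y) (hT θ) t
      simp only
      fun_prop
    rw [lintegral_count_prod hm]
    exact tsum_congr fun t =>
      (M.lintegral_absReward_mul_changeOfMeasure (hT y) (hT θ) hL' t).symm
  -- For almost every trajectory all visited states are points of differentiability, since there are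
  -- countably many times.
  have hDae : ∀ᵐ x ∂μ, HasGradientAt (fun y => l y x) (D x) θ := by
    refine ae_count_prod fun t => ?_
    filter_upwards [ae_all_iff.mpr fun i => M.ae_traj_of_ae_visitation hgrad i] with ω hω
    simp only [hl, log_trajRatio]
    refine HasGradientAt.fun_sum fun i _ => ?_
    rw [hasGradientAt_iff_hasFDerivAt]
    exact (hasGradientAt_log_softmax (f := fun y => T y (ω i).1) (fun c => (hω i c).1)
      (ω i).2).hasFDerivAt.sub_const _
  obtain ⟨hint, hgr⟩ := hasGradientAt_integral_mul_exp hε hfm hKm hK0 hlm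
    hDm.aestronglyMeasurable hlK hBμ hDae
  have hJ : ∀ y ∈ Metric.ball θ ε, M.J (softmaxPolicy (T y) (hT y)) =
      ∫ x, f x * Real.exp (l y x) ∂μ := by
    intro y hy
    have hi : Integrable (fun x => f x * Real.exp (l y x)) μ := by
      have h1 := hlm y
      refine ⟨by fun_prop, lt_of_le_of_lt (lintegral_mono fun x => ?_)
        ((hBμ y hy).trans_lt ENNReal.coe_lt_top)⟩
      rw [← ofReal_norm, norm_mul, Real.norm_eq_abs, Real.norm_of_nonneg (Real.exp_pos _).le]
      refine ENNReal.ofReal_le_ofReal ?_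
      gcongr
      exact le_mul_of_one_le_right (abs_nonneg _) (by linarith [hK0 x])
    rw [M.J_eq_tsum (hr y hy), integral_count_prod hi]
    refine tsum_congr fun t => ?_
    simp only [hexp]
    exact M.integral_traj_changeOfMeasure (hT y) (hT θ) t
      (f := fun z => M.γ ^ t * M.reward z) (by fun_prop)
  rw [← M.integral_reward_smul_score (hT θ) hG hL
    (hgrad.mono fun s hs c => (hs c).2) (hr θ hθ) hrL hint]
  exact hgr.congr_of_eventuallyEq
    (Filter.eventually_of_mem (Metric.ball_mem_nhds θ hε) hJ)

end Gradient

end MDP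

/-! ### Conclusion: the ARS and ARSM gradients -/

lemma gradient_sum_mul_eq {S E : Type*} {C : ℕ} [NormedAddCommGroup E] [InnerProductSpace ℝ E]
    [CompleteSpace E] {T : E → S → Fin C → ℝ} {G : Fin C → S → E} {θ : E} {s : S}
    (h : ∀ c, HasGradientAt (fun y => T y s c) (G c s) θ) (g : Fin C → ℝ) :
    gradient (fun y => ∑ c, g c * T y s c) θ = ∑ c, g c • G c s :=
  (HasGradientAt.fun_sum fun c _ => (h c).const_mul_real (g c)).gradient

theorem proposition1 {S : Type*} [MeasurableSpace S] {C : ℕ} [NeZero C] {d : ℕ}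
    (M : MDP S C)
    (T : EuclideanSpace ℝ (Fin d) → S → Fin C → ℝ) (hT : ∀ θ, Measurable (T θ))
    (θ : EuclideanSpace ℝ (Fin d))
    -- the logits are differentiable at `θ`, and Lipschitz near `θ` with constant `L s`
    (hdiff : ∀ᵐ s ∂(M.visitation (softmaxPolicy (T θ) (hT θ))),
      DifferentiableAt ℝ (fun θ' => T θ' s) θ)
    (ε : ℝ) (hε : 0 < ε) (L : S → ℝ≥0) (hLmeas : Measurable L)
    (hLip : ∀ s, LipschitzOnWith (L s) (fun θ' => T θ' s) (Metric.ball θ ε))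
    -- integrability of the rewards against the Lipschitz constants met so far
    (hdom : ∑' t : ℕ, ⨆ θ' ∈ Metric.ball θ ε,
      ∫⁻ ω, ENNReal.ofReal (M.γ ^ t * |M.reward (ω t)|) *
          (1 + ∑ i ∈ Finset.range (t + 1), (L (ω i).1 : ℝ≥0∞))
        ∂(M.traj (softmaxPolicy (T θ') (hT θ'))) ≠ ∞) :
    let π := softmaxPolicy (T θ) (hT θ)
    let ρ := M.visitation π
    let Dir := dirichlet C (fun _ => 1)
    let J := fun θ' => M.J (softmaxPolicy (T θ') (hT θ'))
    let G_ARS : S × Fin C × (Fin C → ℝ) → EuclideanSpace ℝ (Fin d) := fun x =>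
      gradient (fun θ' => ∑ c, gARS (M.Q π x.1) (T θ x.1) x.2.2 x.2.1 c * T θ' x.1 c) θ
    let G_ARSM : S × (Fin C → ℝ) → EuclideanSpace ℝ (Fin d) := fun x =>
      gradient (fun θ' => ∑ c, gARSM (M.Q π x.1) (T θ x.1) x.2 c * T θ' x.1 c) θ
    -- ARS: the reference category is drawn from `ν`, independently of the state and of `Dir`
    (∀ (ν : Measure (Fin C)) [IsProbabilityMeasure ν],
      Integrable G_ARS (ρ.prod (ν.prod Dir)) ∧
        HasGradientAt J (∫ x, G_ARS x ∂(ρ.prod (ν.prod Dir))) θ) ∧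
    -- ARSM
    (Integrable G_ARSM (ρ.prod Dir) ∧
      HasGradientAt J (∫ x, G_ARSM x ∂(ρ.prod Dir)) θ) := by
  intro π ρ Dir J G_ARS G_ARSM
  obtain ⟨G, hG, hgrad⟩ := exists_measurable_gradient hT hdiff hε hLip
  obtain ⟨B, hBeq⟩ := WithTop.ne_top_iff_exists.mp hdom
  have hB : ∀ y ∈ Metric.ball θ ε, ∑' t : ℕ, ∫⁻ ω, M.absReward t (ω t) *
      (1 + ∑ i ∈ Finset.range (t + 1), (L (ω i).1 : ℝ≥0∞))
        ∂(M.traj (softmaxPolicy (T y) (hT y))) ≤ B := by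
    intro y hy
    refine le_of_le_of_eq ?_ hBeq.symm
    exact ENNReal.tsum_le_tsum fun t => le_iSup₂_of_le y hy le_rfl
  have hJ := M.hasGradientAt_J hT hε hLmeas hLip hB hG hgrad
  have hGL : ∀ᵐ s ∂ρ, ∀ c, ‖G c s‖ₑ ≤ L s := by
    filter_upwards [hgrad] with s hs c
    rw [← ofReal_norm]
    refine (ENNReal.ofReal_le_ofReal (hs c).2).trans ?_
    simp
  have hq : ∀ a, Measurable fun s => M.Q π s a := fun a =>
    (M.measurable_Q π).comp (g := fun z : S × Fin C => M.Q π z.1 z.2)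
      (f := fun s => (s, a)) measurable_prodMk_right
  -- This makes both estimators integrable; it is the part of the domination hypothesis at `θ`
  -- itself that carries the factor `∑ L`.
  have hfin : ∫⁻ s, L s * ∑ a, ENNReal.ofReal (softmax (T θ s) a) * ‖M.Q π s a‖ₑ ∂ρ ≠ ∞ := by
    refine ne_top_of_le_ne_top ENNReal.coe_ne_top
      ((M.lintegral_visitation_mul_Q_le (hT θ) hLmeas.coe_nnreal_ennreal).trans
        (le_trans ?_ (hB θ (Metric.mem_ball_self hε))))
    exact ENNReal.tsum_le_tsum fun t => lintegral_mono fun ω =>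
      mul_le_mul_right le_add_self _
  refine ⟨fun ν _ => ?_, ?_⟩
  · obtain ⟨hi, heq⟩ := integrable_gARS_smul hq (hT θ) hG hGL hfin ν
    -- At states where the logits are not known to be differentiable `gradient` may be a default
    -- value; these are null for the product measure, so the chosen version `G` can be used instead.
    have hae : G_ARS =ᵐ[ρ.prod (ν.prod Dir)]
        fun x => ∑ c, gARS (M.Q π x.1) (T θ x.1) x.2.2 x.2.1 c • G c x.1 := by
      filter_upwards [Measure.quasiMeasurePreserving_fst.ae hgrad] with x hx
      exact gradient_sum_mul_eq (fun c => (hx c).1) _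
    refine ⟨hi.congr hae.symm, ?_⟩
    rw [integral_congr_ae hae, heq]
    exact hJ
  · obtain ⟨hi, heq⟩ := integrable_gARSM_smul hq (hT θ) hG hGL hfin
    have hae : G_ARSM =ᵐ[ρ.prod Dir]
        fun x => ∑ c, gARSM (M.Q π x.1) (T θ x.1) x.2 c • G c x.1 := by
      filter_upwards [Measure.quasiMeasurePreserving_fst.ae hgrad] with x hx
      exact gradient_sum_mul_eq (fun c => (hx c).1) _
    refine ⟨hi.congr hae.symm, ?_⟩
    rw [integral_congr_ae hae, heq]
    exact hJ
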